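/- Let $\Bbbk$ be a commutative ring. All operads are symmetric operads of $\Bbbk$-modules, with right actions $*$ of the symmetric groups $\mathbb S_n$, identity $\mathbf 1\in\mathcal P(1)$ and partial compositions $\circ_i$. An endomorphism of an operad $\mathcal P$ is a family of $\Bbbk$-linear maps $\mathcal P(n)\to\mathcal P(n)$, $n\ge 0$, preserving $\mathbf 1$, the $\mathbb S_n$-actions and the maps $\circ_i$; $\mathrm{End}(\mathcal P)$ is the monoid of endomorphisms and $\mathrm{Aut}(\mathcal P)$ the group of invertible ones. $\mathrm{IAut}(\mathcal P)$ is the normal subgroup of inner automorphisms $\theta\mapsto(\lambda^{-1}\circ\theta)\circ(\lambda,\dots,\lambda)$, for invertible $\lambda\in\mathcal P(1)$, and $\mathrm{OAut}(\mathcal P)=\mathrm{Aut}(\mathcal P)/\mathrm{IAut}(\mathcal P)$. For $c\in\Bbbk^\times$ let $\mathrm{s}_c\in\mathrm{Aut}(\mathcal P)$ be $\theta\mapsto c^{\,n-1}\theta$ for $\theta\in\mathcal P(n)$. If $\mathcal P(0)$ is spanned by an element $\mathbf 1_0$, the $K$-th truncation ideal ${}^K\mathcal I$ ($K\geq 1$)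 is defined by ${}^K\mathcal I(n)=0$ for $n<K$, and for $n\ge K$ by ${}^K\mathcal I(n)=\bigcap_{|I|=K-1}\ker\pi^I$, where for $I\subseteq\{1,\dots,n\}$ with characteristic function $\chi_I$ the operator $\pi^I:\mathcal P(n)\to\mathcal P(|I|)$ is $\theta\mapsto\theta\circ(\mathbf 1_{\chi_I(1)},\dots,\mathbf 1_{\chi_I(n)})$, with $\mathbf 1_1=\mathbf 1$. Let $\mathrm{As}$ be the operad of unital associative algebras, $\mathrm{As}(n)=\Bbbk\mathbb S_n$. Let $\mathrm{Lie}$ be the operad generated by $b\in\mathrm{Lie}(2)$ subject to $b*(12)=-b$ and $b\circ_2 b=b\circ_1 b+(b\circ_2 b)*(12)$. Let $\mathrm{Pois}$ be the operad of unital commutative Poisson algebras, generated by $\mathbf 1_0$ (arity $0$) and $\mathbf 1_2,b$ (arity $2$) subject to $\mathbf 1_2\circ_1\mathbf 1_0=\mathbf 1_2\circ_2\mathbf 1_0=\mathbf 1$, $b\circ_1\mathbf 1_0=b\circ_2\mathbf 1_0=0$, $\mathbf 1_2*(12)=\mathbf 1_2$, $b*(12)=-b$, $\mathbf 1_2\circ_1\mathbf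 1_2=\mathbf 1_2\circ_2\mathbf 1_2$, $b\circ_1\mathbf 1_2=\mathbf 1_2\circ_2 b+(\mathbf 1_2\circ_2 b)*(12)$ and $b\circ_2 b=b\circ_1 b+(b\circ_2 b)*(12)$. Then: 1. Suppose that $\Bbbk\ne 0$ has no idempotents other than $0$ and $1$, and let $\mathcal P=\mathrm{As}$ or $\mathcal P=\mathrm{As}/{}^K\mathcal I$ with $K\ge 4$. Then $c\mapsto \mathrm s_c$ is an isomorphism $\Bbbk^\times\cong\mathrm{IAut}(\mathcal P)$; it extends to an isomorphism $\Bbbk^\times\rtimes\mathbb Z_2\cong\mathrm{Aut}(\mathcal P)$ (for the trivial action of $\mathbb Z_2$ on $\Bbbk^\times$); $\mathrm{OAut}(\mathcal P)\cong\mathbb Z_2$; and $\mathrm{End}(\mathcal P)=\mathrm{Aut}(\mathcal P)$. 2. For $\mathcal P=\mathrm{Lie}$ (and arbitrary $\Bbbk$), $c\mapsto \mathrm s_c$ is an isomorphism $\Bbbk^\times\cong\mathrm{IAut}(\mathcal P)$; $\mathrm{Aut}(\mathcal P)=\mathrm{IAut}(\mathcal P)$, so that $\mathrm{OAut}(\mathcal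 P)=\{1\}$; and there is an isomorphism of $\mathrm{End}(\mathcal P)$ with the multiplicative monoid of $\Bbbk$ under which $\mathrm s_c$ corresponds to $c$. 3. Suppose that $0$ is the only $e\in\Bbbk$ with $2e=0$ and $e^2=0$ (for example, $\Bbbk$ is a field, or $2$ is not a zero divisor in $\Bbbk$), and let $\mathcal P=\mathrm{Pois}$ or $\mathcal P=\mathrm{Pois}/{}^K\mathcal I$ with $K\ge 3$; if $\mathcal P=\mathrm{Pois}/{}^3\mathcal I$, suppose moreover that $2e=0$ implies $e=0$ for all $e\in\Bbbk$. Then $c\mapsto \mathrm s_c$ is an isomorphism $\Bbbk^\times\cong\mathrm{IAut}(\mathcal P)$; there is a group isomorphism $\mathrm{Aut}(\mathcal P)\cong\Bbbk^\times\times\Bbbk^\times$ under which $\mathrm s_c$ corresponds to $(c,c)$; $\mathrm{OAut}(\mathcal P)\cong\Bbbk^\times$; and there is an isomorphism of $\mathrm{End}(\mathcal P)$ with the multiplicative monoid $\Bbbk\times\Bbbk^\times$ under which $\mathrm s_c$ corresponds to $(c,c)$. -/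

import Mathlib

universe u v

/-! ## Partial composition of permutations -/

/-- The inputs of `μ ∘ᵢ ν`, for `μ` of arity `m` and `ν` of arity `n`, are the inputs `j ≠ i` of `μ`
and the inputs of `ν`. This bijection gives the position (counted from `0`) of each of them:
`j < i` stays, `j > i` moves to `j + n - 1`, and the input `t` of `ν` moves to `i + t`.
The total arity `r = m + n - 1` is encoded by `r + 1 = m + n`. -/
def insEquiv {m n r : ℕ} (h : r + 1 = m + n) (i : Fin m) :
    {j : Fin m // j ≠ i} ⊕ Fin n ≃ Fin r where
  toFun
    | Sum.inl j =>
        if hj : j.1.1 < i.1 then ⟨j.1.1, by have := i.2; omega⟩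
        else ⟨j.1.1 + n - 1, by
          have h1 := j.1.2
          have h2 : j.1.1 ≠ i.1 := fun e => j.2 (Fin.ext e)
          omega⟩
    | Sum.inr t => ⟨i.1 + t.1, by have := t.2; have := i.2; omega⟩
  invFun p :=
    if h1 : p.1 < i.1 then
      Sum.inl ⟨⟨p.1, by have := i.2; omega⟩, fun e => by have := congrArg Fin.val e; simp at this; omega⟩
    else if h2 : p.1 < i.1 + n then Sum.inr ⟨p.1 - i.1, by omega⟩
    else Sum.inl ⟨⟨p.1 + 1 - n, by have := p.2; omega⟩,
      fun e => by have := congrArg Fin.val e; simp at this; omega⟩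
  left_inv := by
    rintro (⟨j, hj⟩ | t)
    · have h2 : j.1 ≠ i.1 := fun e => hj (Fin.ext e)
      have h3 := i.2
      by_cases h1 : j.1 < i.1
      · simp [h1]
      · have h4 : ¬ (j.1 + n - 1 < i.1) := by omega
        have h5 : ¬ (j.1 + n - 1 < i.1 + n) := by omega
        simp only [h1, dite_false, h4, h5]
        congr 2
        apply Fin.ext
        simp only
        omega
    · have h1 : ¬ (i.1 + t.1 < i.1) := by omega
      simp [h1]
  right_inv := by
    intro p
    by_cases h1 : p.1 < i.1
    · simp [h1]
    · by_cases h2 : p.1 < i.1 + n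
      · simp only [h1, dite_false, h2, dite_true]
        apply Fin.ext
        simp only
        omega
      · have h3 : ¬ (p.1 + 1 - n < i.1) := by omega
        simp only [h1, dite_false, h2, h3]
        apply Fin.ext
        simp only
        omega

/-- The partial composition `φ ∘ᵢ σ` of permutations, `φ` of `m` letters and `σ` of `n` letters:
the block permutation sending the input `j ≠ i` of `φ` to the input `φ j`, and the input `t` of the
inserted block to the input `σ t` of the block inserted at `φ i`. -/
def permComp {m n r : ℕ} (h : r + 1 = m + n) (φ : Equiv.Perm (Fin m)) (i : Fin m)
    (σ : Equiv.Perm (Fin n)) : Equiv.Perm (Fin r) :=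
  (insEquiv h i).symm.trans
    ((Equiv.sumCongr
      (φ.subtypeEquiv (fun j => by simp : ∀ j, j ≠ i ↔ φ j ≠ φ i)) σ).trans
      (insEquiv h (φ i)))

theorem permComp_inl {m n r : ℕ} (h : r + 1 = m + n) (φ : Equiv.Perm (Fin m)) (i : Fin m)
    (σ : Equiv.Perm (Fin n)) (p : Fin r) (j : Fin m) (hj : j ≠ i)
    (hp : p.1 = if j.1 < i.1 then j.1 else j.1 + n - 1) :
    (permComp h φ i σ p).1 = if (φ j).1 < (φ i).1 then (φ j).1 else (φ j).1 + n - 1 := by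
  have e : p = insEquiv h i (Sum.inl ⟨j, hj⟩) := by
    apply Fin.ext
    rw [hp]
    simp only [insEquiv, Equiv.coe_fn_mk]
    split_ifs <;> rfl
  subst e
  simp only [permComp, Equiv.trans_apply, Equiv.symm_apply_apply, Equiv.sumCongr_apply, Sum.map_inl,
    Equiv.subtypeEquiv_apply]
  simp only [insEquiv, Equiv.coe_fn_mk]
  split_ifs <;> rfl

theorem permComp_inr {m n r : ℕ} (h : r + 1 = m + n) (φ : Equiv.Perm (Fin m)) (i : Fin m)
    (σ : Equiv.Perm (Fin n)) (p : Fin r) (t : Fin n) (hp : p.1 = i.1 + t.1) :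
    (permComp h φ i σ p).1 = (φ i).1 + (σ t).1 := by
  have e : p = insEquiv h i (Sum.inr t) := Fin.ext hp
  subst e
  simp only [permComp, Equiv.trans_apply, Equiv.symm_apply_apply, Equiv.sumCongr_apply, Sum.map_inr]
  rfl

theorem ins_cases {m n r : ℕ} (h : r + 1 = m + n) (i : Fin m) (p : Fin r) :
    (∃ j : Fin m, j ≠ i ∧ p.1 = if j.1 < i.1 then j.1 else j.1 + n - 1) ∨
      ∃ t : Fin n, p.1 = i.1 + t.1 := by
  obtain ⟨x, rfl⟩ := (insEquiv h i).surjective p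
  rcases x with ⟨j, hj⟩ | t
  · refine Or.inl ⟨j, hj, ?_⟩
    simp only [insEquiv, Equiv.coe_fn_mk]
    split_ifs <;> rfl
  · exact Or.inr ⟨t, rfl⟩

theorem permComp_mul {m n r : ℕ} (h : r + 1 = m + n) (φ ψ : Equiv.Perm (Fin m)) (i : Fin m)
    (σ τ : Equiv.Perm (Fin n)) :
    permComp h (φ * ψ) i (σ * τ) = permComp h φ (ψ i) σ * permComp h ψ i τ := by
  ext p
  rcases ins_cases h i p with ⟨j, hj, hp⟩ | ⟨t, hp⟩
  · exact (permComp_inl h (φ * ψ) i (σ * τ) p j hj hp).trans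
      (permComp_inl h φ (ψ i) σ _ (ψ j) (by simpa using hj) (permComp_inl h ψ i τ p j hj hp)).symm
  · exact (permComp_inr h (φ * ψ) i (σ * τ) p t hp).trans
      (permComp_inr h φ (ψ i) σ _ (τ t) (permComp_inr h ψ i τ p t hp)).symm

theorem permComp_one_right {n : ℕ} (h : n + 1 = n + 1) (φ : Equiv.Perm (Fin n)) (i : Fin n) :
    permComp h φ i (1 : Equiv.Perm (Fin 1)) = φ := by
  ext p
  rcases ins_cases h i p with ⟨j, hj, hp⟩ | ⟨t, hp⟩
  · have e : p = j := Fin.ext (by rw [hp]; split_ifs <;> rfl)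
    rw [permComp_inl h _ i _ p j hj hp, e]
    split_ifs <;> simp
  · have e : p = i := Fin.ext (by have := t.2; omega)
    rw [permComp_inr h _ i _ p t hp, e]
    simp

theorem permComp_one_left {n : ℕ} (h : n + 1 = 1 + n) (σ : Equiv.Perm (Fin n)) :
    permComp h (1 : Equiv.Perm (Fin 1)) 0 σ = σ := by
  ext p
  rcases ins_cases h 0 p with ⟨j, hj, hp⟩ | ⟨t, hp⟩
  · exact absurd (Subsingleton.elim j 0) hj
  · have e : p = t := Fin.ext (by simpa using hp)
    rw [permComp_inr h _ 0 _ p t hp, e]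
    simp

theorem permComp_assoc {l m n a b s : ℕ} (h₁ : a + 1 = l + m) (h₂ : s + 1 = a + n)
    (h₃ : b + 1 = m + n) (h₄ : s + 1 = l + b) (i : Fin l) (j : Fin m) (q : Fin a)
    (hq : q.1 = i.1 + j.1) (α : Equiv.Perm (Fin l)) (β : Equiv.Perm (Fin m))
    (γ : Equiv.Perm (Fin n)) :
    permComp h₂ (permComp h₁ α i β) q γ = permComp h₄ α i (permComp h₃ β j γ) := by
  have hαq : (permComp h₁ α i β q).1 = (α i).1 + (β j).1 := permComp_inr h₁ α i β q j hq
  ext p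
  rcases ins_cases h₄ i p with ⟨x, hx, hp⟩ | ⟨y, hp⟩
  · rw [permComp_inl h₄ α i _ p x hx hp]
    have hx' : x.1 ≠ i.1 := fun e => hx (Fin.ext e)
    have hαx : (α x).1 ≠ (α i).1 := fun e => hx (α.injective (Fin.ext e))
    have hj := j.2
    have hβj := (β j).2
    have hxl := x.2
    have hil := i.2
    obtain ⟨z, hz⟩ : ∃ z : Fin a, z.1 = if x.1 < i.1 then x.1 else x.1 + m - 1 :=
      ⟨⟨if x.1 < i.1 then x.1 else x.1 + m - 1, by split_ifs <;> omega⟩, rfl⟩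
    have hzq : z ≠ q := fun e => by
      have := congrArg Fin.val e
      split_ifs at hz <;> omega
    rw [permComp_inl h₂ _ q γ p z hzq (by split_ifs at * <;> omega), hαq,
      permComp_inl h₁ α i β z x hx hz]
    split_ifs <;> omega
  · rw [permComp_inr h₄ α i _ p y hp]
    rcases ins_cases h₃ j y with ⟨x, hx, hy⟩ | ⟨t, hy⟩
    · rw [permComp_inl h₃ β j γ y x hx hy]
      have hx' : x.1 ≠ j.1 := fun e => hx (Fin.ext e)
      have hxl := x.2
      have hil := i.2
      obtain ⟨z, hz⟩ : ∃ z : Fin a, z.1 = i.1 + x.1 := ⟨⟨i.1 + x.1, by omega⟩, rfl⟩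
      have hzq : z ≠ q := fun e => by
        have := congrArg Fin.val e
        omega
      have hβx : (β x).1 ≠ (β j).1 := fun e => hx (β.injective (Fin.ext e))
      rw [permComp_inl h₂ _ q γ p z hzq (by split_ifs at * <;> omega), hαq,
        permComp_inr h₁ α i β z x hz]
      split_ifs <;> omega
    · rw [permComp_inr h₃ β j γ y t hy, permComp_inr h₂ _ q γ p t (by omega), hαq]
      omega

theorem permComp_comm {l m n a b s : ℕ} (h₁ : a + 1 = l + m) (h₂ : s + 1 = a + n)
    (h₃ : b + 1 = l + n) (h₄ : s + 1 = b + m) (i c : Fin l) (hic : i.1 < c.1) (q : Fin a)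
    (hq : q.1 + 1 = c.1 + m) (q' : Fin b) (hq' : q'.1 = i.1) (α : Equiv.Perm (Fin l))
    (β : Equiv.Perm (Fin m)) (γ : Equiv.Perm (Fin n)) :
    permComp h₂ (permComp h₁ α i β) q γ = permComp h₄ (permComp h₃ α c γ) q' β := by
  have hcl := c.2
  have hci : c ≠ i := fun e => by rw [e] at hic; omega
  have hαci : (α c).1 ≠ (α i).1 := fun e => hci (α.injective (Fin.ext e))
  have hα := permComp_inl h₁ α i β q c hci (by rw [if_neg (by omega)]; omega)
  have hα' := permComp_inl h₃ α c γ q' i hci.symm (by split_ifs <;> omega)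
  have := (α c).2
  have := (α i).2
  ext p
  rcases ins_cases h₂ q p with ⟨z, hz, hp⟩ | ⟨t, hp⟩
  · have hz' : z.1 ≠ q.1 := fun e => hz (Fin.ext e)
    rw [permComp_inl h₂ _ q γ p z hz hp, hα]
    rcases ins_cases h₁ i z with ⟨x, hx, hzx⟩ | ⟨t, ht⟩
    · rw [permComp_inl h₁ α i β z x hx hzx]
      have hx' : x.1 ≠ i.1 := fun e => hx (Fin.ext e)
      have hαx : (α x).1 ≠ (α i).1 := fun e => hx (α.injective (Fin.ext e))
      have hxl := x.2
      have hxc : x ≠ c := fun e => by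
        subst e
        split_ifs at hzx <;> omega
      have hxc' : x.1 ≠ c.1 := fun e => hxc (Fin.ext e)
      have hαxc : (α x).1 ≠ (α c).1 := fun e => hxc (α.injective (Fin.ext e))
      have := (α x).2
      obtain ⟨w, hw⟩ : ∃ w : Fin b, w.1 = if x.1 < c.1 then x.1 else x.1 + n - 1 :=
        ⟨⟨if x.1 < c.1 then x.1 else x.1 + n - 1, by split_ifs <;> omega⟩, rfl⟩
      have hwq : w ≠ q' := fun e => by
        have := congrArg Fin.val e
        split_ifs at hw <;> omega
      rw [permComp_inl h₄ _ q' β p w hwq (by clear hα hα'; split_ifs at hp hzx hw ⊢ <;> omega), hα',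
        permComp_inl h₃ α c γ w x hxc hw]
      clear hα hα' hp hzx hw
      split_ifs <;> omega
    · have := t.2
      have := (β t).2
      rw [permComp_inr h₁ α i β z t ht,
        permComp_inr h₄ _ q' β p t (by clear hα hα'; split_ifs at hp <;> omega), hα']
      clear hα hα' hp
      split_ifs <;> omega
  · have := t.2
    have := (γ t).2
    rw [permComp_inr h₂ _ q γ p t hp, hα]
    obtain ⟨w, hw⟩ : ∃ w : Fin b, w.1 = c.1 + t.1 := ⟨⟨c.1 + t.1, by omega⟩, rfl⟩
    have hwq : w ≠ q' := fun e => by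
      have := congrArg Fin.val e
      omega
    rw [permComp_inl h₄ _ q' β p w hwq (by clear hα hα'; split_ifs <;> omega), hα',
      permComp_inr h₃ α c γ w t hw]
    clear hα hα' hp hw
    split_ifs <;> omega

/-! ## Symmetric operads -/

/-- A symmetric operad over a commutative ring `k`, in the partial-composition presentation:
right `k`-linear actions of the symmetric groups on modules `P n`, an identity in `P 1`, and bilinear
partial compositions `∘ᵢ : P m ⊗ P n → P (m + n - 1)`. Inputs are numbered from `0`. To avoid
transports between the modules `P n`, the arity `r` of a composite is a separate variable together
with a proof of `r + 1 = m + n` (`i : Fin m` forces `m ≥ 1`); likewise the positions that occur in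
the associativity axioms are variables pinned down by equations. -/
structure SymOperad (k : Type u) [CommRing k] where
  obj : ℕ → Type v
  [acg : ∀ n, AddCommGroup (obj n)]
  [mod : ∀ n, Module k (obj n)]
  /-- the right action, `act σ θ = θ * σ` -/
  act : ∀ {n : ℕ}, Equiv.Perm (Fin n) → obj n →ₗ[k] obj n
  one : obj 1
  /-- `comp h i μ ν = μ ∘ᵢ ν` -/
  comp : ∀ {m n r : ℕ}, r + 1 = m + n → Fin m → obj m →ₗ[k] obj n →ₗ[k] obj r
  act_one : ∀ {n : ℕ} (θ : obj n), act 1 θ = θ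
  act_mul : ∀ {n : ℕ} (σ τ : Equiv.Perm (Fin n)) (θ : obj n), act (σ * τ) θ = act τ (act σ θ)
  comp_one : ∀ {n : ℕ} (h : n + 1 = n + 1) (i : Fin n) (θ : obj n), comp h i θ one = θ
  one_comp : ∀ {n : ℕ} (h : n + 1 = 1 + n) (θ : obj n), comp h 0 one θ = θ
  /-- `(α ∘ᵢ β) ∘_{i+j} γ = α ∘ᵢ (β ∘ⱼ γ)` -/
  assoc : ∀ {l m n a b s : ℕ} (h₁ : a + 1 = l + m) (h₂ : s + 1 = a + n) (h₃ : b + 1 = m + n)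
    (h₄ : s + 1 = l + b) (i : Fin l) (j : Fin m) (q : Fin a), q.1 = i.1 + j.1 →
    ∀ (α : obj l) (β : obj m) (γ : obj n),
      comp h₂ q (comp h₁ i α β) γ = comp h₄ i α (comp h₃ j β γ)
  /-- `(α ∘ᵢ β) ∘_{c+m-1} γ = (α ∘_c γ) ∘ᵢ β` for `i < c`, where `m` is the arity of `β` -/
  comm : ∀ {l m n a b s : ℕ} (h₁ : a + 1 = l + m) (h₂ : s + 1 = a + n) (h₃ : b + 1 = l + n)
    (h₄ : s + 1 = b + m) (i c : Fin l), i.1 < c.1 → ∀ (q : Fin a), q.1 + 1 = c.1 + m →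
    ∀ (q' : Fin b), q'.1 = i.1 → ∀ (α : obj l) (β : obj m) (γ : obj n),
      comp h₂ q (comp h₁ i α β) γ = comp h₄ q' (comp h₃ c α γ) β
  comp_act : ∀ {m n r : ℕ} (h : r + 1 = m + n) (i : Fin m) (μ : obj m) (ν : obj n)
    (σ : Equiv.Perm (Fin n)), comp h i μ (act σ ν) = act (permComp h 1 i σ) (comp h i μ ν)
  act_comp : ∀ {m n r : ℕ} (h : r + 1 = m + n) (i : Fin m) (μ : obj m) (ν : obj n)
    (φ : Equiv.Perm (Fin m)),
      comp h i (act φ μ) ν = act (permComp h φ i 1) (comp h (φ i) μ ν)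

attribute [instance] SymOperad.acg SymOperad.mod

namespace SymOperad

variable {k : Type u} [CommRing k]

/-! ## Endomorphisms and automorphisms -/

/-- An endomorphism of an operad: a family of `k`-linear maps `P n → P n` that preserves the
identity, the symmetric group actions and the partial compositions. -/
@[ext]
structure EndHom (P : SymOperad.{u, v} k) where
  app : ∀ n, P.obj n →ₗ[k] P.obj n
  app_one : app 1 P.one = P.one
  app_act : ∀ {n : ℕ} (σ : Equiv.Perm (Fin n)) (θ : P.obj n),
    app n (P.act σ θ) = P.act σ (app n θ)
  app_comp : ∀ {m n r : ℕ} (h : r + 1 = m + n) (i : Fin m) (μ : P.obj m) (ν : P.obj n),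
    app r (P.comp h i μ ν) = P.comp h i (app m μ) (app n ν)

/-- Endomorphisms form a monoid under composition. -/
instance (P : SymOperad.{u, v} k) : Monoid P.EndHom where
  mul Φ Ψ :=
    { app := fun n => (Φ.app n).comp (Ψ.app n)
      app_one := by simp [Ψ.app_one, Φ.app_one]
      app_act := fun σ θ => by simp [Ψ.app_act, Φ.app_act]
      app_comp := fun h i μ ν => by simp [Ψ.app_comp, Φ.app_comp] }
  one :=
    { app := fun _ => LinearMap.id
      app_one := rfl
      app_act := fun _ _ => rfl
      app_comp := fun _ _ _ _ => rfl }
  mul_assoc _ _ _ := rfl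
  one_mul _ := rfl
  mul_one _ := rfl

/-- The automorphism group: the invertible endomorphisms. -/
abbrev AutGroup (P : SymOperad.{u, v} k) : Type v := (P.EndHom)ˣ

theorem EndHom.mul_app (P : SymOperad.{u, v} k) (Φ Ψ : P.EndHom) (n : ℕ) (θ : P.obj n) :
    (Φ * Ψ).app n θ = Φ.app n (Ψ.app n θ) := rfl

theorem EndHom.one_app (P : SymOperad.{u, v} k) (n : ℕ) (θ : P.obj n) :
    (1 : P.EndHom).app n θ = θ := rfl

/-- The superfluous endomorphism `θ ↦ c ^ (n - 1) θ`, for `θ` of arity `n` and a unit `c`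
(the exponent is an integer: it is `-1` in arity `0`). -/
def scaleEnd (P : SymOperad.{u, v} k) (c : kˣ) : P.EndHom where
  app n := ((c ^ ((n : ℤ) - 1) : kˣ) : k) • LinearMap.id
  app_one := by simp
  app_act σ θ := by simp
  app_comp {m n r} h i μ ν := by
    have e : ((r : ℤ) - 1) = ((n : ℤ) - 1) + ((m : ℤ) - 1) := by omega
    simp [smul_smul, e, zpow_add]

/-- The superfluous automorphisms, as a group homomorphism from the units of `k`. -/
def scale (P : SymOperad.{u, v} k) : kˣ →* P.AutGroup :=
  MonoidHom.toHomUnits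
    { toFun := P.scaleEnd
      map_one' := by
        ext n θ
        simp [scaleEnd, EndHom.one_app]
      map_mul' := fun c d => by
        ext n θ
        simp [scaleEnd, EndHom.mul_app, smul_smul, mul_zpow, mul_comm] }

/-! ## Full compositions -/

/-- Auxiliary to `compAll`: plug `x i` into the inputs `i < t`, starting with the last of them.
The arity of the result is `r = N - t + ∑ i, a i`. -/
def compAux (P : SymOperad.{u, v} k) : (t : ℕ) → {N r : ℕ} → (a : Fin t → ℕ) →
    (∀ i, P.obj (a i)) → t ≤ N → r + t = N + ∑ i, a i → P.obj N →ₗ[k] P.obj r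
  | 0, N, r, _, _, _, h =>
      have e : N = r := by simpa using h.symm
      e ▸ LinearMap.id
  | t + 1, N, _, a, x, ht, h =>
      (compAux P t (N := N + a (Fin.last t) - 1) (fun i => a i.castSucc) (fun i => x i.castSucc)
        (by omega) (by rw [Fin.sum_univ_castSucc] at h; omega)).comp
      ((P.comp (by omega) (⟨t, ht⟩ : Fin N)).flip (x (Fin.last t)))

/-- The full composition `θ ∘ (x₁, …, xₙ)`, of arity the sum of the arities of the `xᵢ`. -/
def compAll (P : SymOperad.{u, v} k) {n r : ℕ} (a : Fin n → ℕ) (x : ∀ i, P.obj (a i))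
    (h : ∑ i, a i = r) : P.obj n →ₗ[k] P.obj r :=
  P.compAux n a x le_rfl (by omega)

theorem compAux_succ (P : SymOperad.{u, v} k) {t N N' r : ℕ} (a : Fin (t + 1) → ℕ)
    (x : ∀ i, P.obj (a i)) (ht : t + 1 ≤ N) (h : r + (t + 1) = N + ∑ i, a i)
    (hN : N' + 1 = N + a (Fin.last t)) (ht' : t ≤ N')
    (h' : r + t = N' + ∑ i : Fin t, a i.castSucc) (θ : P.obj N) :
    P.compAux (t + 1) a x ht h θ =
      P.compAux t (fun i => a i.castSucc) (fun i => x i.castSucc) ht' h'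
        (P.comp hN ⟨t, ht⟩ θ (x (Fin.last t))) := by
  obtain rfl : N' = N + a (Fin.last t) - 1 := by omega
  rfl

/-! ## Inner and outer automorphisms -/

/-- `θ ∘ (x, …, x)` for `x` of arity `1`. -/
def plugAll (P : SymOperad.{u, v} k) (x : P.obj 1) (n : ℕ) : P.obj n →ₗ[k] P.obj n :=
  P.compAll (fun _ => 1) (fun _ => x) (by simp)

theorem compAux_plug_comm (P : SymOperad.{u, v} k) (x y : P.obj 1) {N : ℕ} (t : ℕ) (ht : t ≤ N)
    (h : N + t = N + ∑ _i : Fin t, 1) (j : Fin N) (hj : t ≤ j.1) (θ : P.obj N) :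
    P.compAux t (fun _ => 1) (fun _ => x) ht h (P.comp rfl j θ y) =
      P.comp rfl j (P.compAux t (fun _ => 1) (fun _ => x) ht h θ) y := by
  induction t generalizing θ with
  | zero => rfl
  | succ t ih =>
    rw [P.compAux_succ (N' := N) _ _ ht h rfl (by omega) (by simp),
      P.compAux_succ (N' := N) _ _ ht h rfl (by omega) (by simp), ← ih (by omega) (by simp) (by omega)]
    congr 1
    exact (P.comm rfl rfl rfl rfl ⟨t, ht⟩ j (by simp; omega) j rfl ⟨t, ht⟩ rfl θ x y).symm

theorem compAux_plug_mul (P : SymOperad.{u, v} k) (x y : P.obj 1) {N : ℕ} (t : ℕ) (ht : t ≤ N)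
    (h : N + t = N + ∑ _i : Fin t, 1) (θ : P.obj N) :
    P.compAux t (fun _ => 1) (fun _ => P.comp rfl 0 x y) ht h θ =
      P.compAux t (fun _ => 1) (fun _ => y) ht h
        (P.compAux t (fun _ => 1) (fun _ => x) ht h θ) := by
  induction t generalizing θ with
  | zero => rfl
  | succ t ih =>
    rw [P.compAux_succ (N' := N) _ _ ht h rfl (by omega) (by simp),
      P.compAux_succ (N' := N) _ _ ht h rfl (by omega) (by simp),
      P.compAux_succ (N' := N) _ _ ht h rfl (by omega) (by simp),
      ih, ← P.compAux_plug_comm x y t (by omega) (by simp) ⟨t, ht⟩ le_rfl]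
    congr 2
    exact (P.assoc rfl rfl rfl rfl ⟨t, ht⟩ 0 ⟨t, ht⟩ rfl θ x y).symm

theorem plugAll_mul (P : SymOperad.{u, v} k) (x y : P.obj 1) (n : ℕ) (θ : P.obj n) :
    P.plugAll (P.comp rfl 0 x y) n θ = P.plugAll y n (P.plugAll x n θ) :=
  P.compAux_plug_mul x y n _ _ θ

theorem plugAll_one (P : SymOperad.{u, v} k) (n : ℕ) (θ : P.obj n) : P.plugAll P.one n θ = θ := by
  have key : ∀ (t : ℕ) (ht : t ≤ n) (h : n + t = n + ∑ _i : Fin t, 1),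
      P.compAux t (fun _ => 1) (fun _ => P.one) ht h θ = θ := by
    intro t
    induction t with
    | zero => intro _ _; rfl
    | succ t ih =>
      intro ht h
      rw [P.compAux_succ (N' := n) _ _ ht h rfl (by omega) (by simp), P.comp_one]
      exact ih _ _
  exact key n _ _

theorem plugAll_comp (P : SymOperad.{u, v} k) (x y : P.obj 1) (n : ℕ) (θ : P.obj n) :
    P.plugAll x n (P.comp (by omega) 0 y θ) = P.comp (by omega) 0 y (P.plugAll x n θ) := by
  have key : ∀ (t : ℕ) (ht : t ≤ n) (h : n + t = n + ∑ _i : Fin t, 1) (θ : P.obj n),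
      P.compAux t (fun _ => 1) (fun _ => x) ht h (P.comp (by omega) 0 y θ) =
        P.comp (by omega) 0 y (P.compAux t (fun _ => 1) (fun _ => x) ht h θ) := by
    intro t
    induction t with
    | zero => intro _ _ _; rfl
    | succ t ih =>
      intro ht h θ
      rw [P.compAux_succ (N' := n) _ _ ht h rfl (by omega) (by simp),
        P.compAux_succ (N' := n) _ _ ht h rfl (by omega) (by simp), ← ih]
      congr 1
      exact P.assoc _ _ _ _ 0 ⟨t, ht⟩ ⟨t, ht⟩ (by simp) y θ x
  exact key n _ _ θ

theorem app_plugAll (P : SymOperad.{u, v} k) (Φ : P.EndHom) (x : P.obj 1) (n : ℕ) (θ : P.obj n) :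
    Φ.app n (P.plugAll x n θ) = P.plugAll (Φ.app 1 x) n (Φ.app n θ) := by
  have key : ∀ (t : ℕ) (ht : t ≤ n) (h : n + t = n + ∑ _i : Fin t, 1) (θ : P.obj n),
      Φ.app n (P.compAux t (fun _ => 1) (fun _ => x) ht h θ) =
        P.compAux t (fun _ => 1) (fun _ => Φ.app 1 x) ht h (Φ.app n θ) := by
    intro t
    induction t with
    | zero => intro _ _ _; rfl
    | succ t ih =>
      intro ht h θ
      rw [P.compAux_succ (N' := n) _ _ ht h rfl (by omega) (by simp),
        P.compAux_succ (N' := n) _ _ ht h rfl (by omega) (by simp), ih, Φ.app_comp]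
  exact key n _ _ θ

/-- `Φ` is the inner automorphism `θ ↦ (y ∘ θ) ∘ (x, …, x)` given by an invertible element `x` of
the algebra `P 1`, with inverse `y`. -/
def IsInnerBy (P : SymOperad.{u, v} k) (Φ : P.EndHom) (x y : P.obj 1) : Prop :=
  P.comp rfl 0 x y = P.one ∧ P.comp rfl 0 y x = P.one ∧
    ∀ (n : ℕ) (θ : P.obj n), Φ.app n θ = P.plugAll x n (P.comp (by omega) 0 y θ)

/-- The subgroup of inner automorphisms. -/
def IAut (P : SymOperad.{u, v} k) : Subgroup P.AutGroup where
  carrier := {Φ | ∃ x y : P.obj 1, P.IsInnerBy Φ.1 x y}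
  one_mem' := ⟨P.one, P.one, P.one_comp _ _, P.one_comp _ _, fun n θ => by
    rw [P.plugAll_one, P.one_comp]; rfl⟩
  mul_mem' := by
    rintro Φ Ψ ⟨x, y, hxy, hyx, hΦ⟩ ⟨x', y', hxy', hyx', hΨ⟩
    have key : ∀ a b c d : P.obj 1, P.comp rfl 0 b c = P.one → P.comp rfl 0 a d = P.one →
        P.comp (r := 1) rfl 0 (P.comp (r := 1) rfl 0 a b) (P.comp (r := 1) rfl 0 c d) = P.one := by
      intro a b c d h1 h2
      rw [P.assoc (b := 1) rfl rfl rfl rfl 0 0 0 rfl, ← P.assoc (a := 1) rfl rfl rfl rfl 0 0 0 rfl b,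
        h1, P.one_comp, h2]
    refine ⟨P.comp rfl 0 x' x, P.comp rfl 0 y y', key _ _ _ _ hxy hxy', key _ _ _ _ hyx' hyx, ?_⟩
    intro n θ
    rw [Units.val_mul, EndHom.mul_app, hΨ, hΦ, P.plugAll_mul, ← P.plugAll_comp]
    congr 2
    exact (P.assoc (b := n) rfl (by omega) (by omega) (by omega) 0 0 0 rfl y y' θ).symm
  inv_mem' := by
    rintro Φ ⟨x, y, hxy, hyx, hΦ⟩
    refine ⟨y, x, hyx, hxy, fun n θ => ?_⟩
    have h1 : Φ.1.app n (P.plugAll y n (P.comp (by omega) 0 x θ)) = θ := by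
      rw [hΦ, ← P.plugAll_comp, ← P.plugAll_mul, hyx, P.plugAll_one,
        ← P.assoc (a := 1) rfl (by omega) (by omega) (by omega) 0 0 0 rfl y x θ, hyx, P.one_comp]
    have h2 : ∀ z, (Φ⁻¹).1.app n (Φ.1.app n z) = z := fun z => by
      rw [← EndHom.mul_app, Units.inv_mul, EndHom.one_app]
    conv_lhs => rw [← h1]
    rw [h2]

instance (P : SymOperad.{u, v} k) : P.IAut.Normal where
  conj_mem := by
    rintro Φ ⟨x, y, hxy, hyx, hΦ⟩ Ψ
    refine ⟨Ψ.1.app 1 x, Ψ.1.app 1 y, ?_, ?_, fun n θ => ?_⟩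
    · rw [← Ψ.1.app_comp, hxy, Ψ.1.app_one]
    · rw [← Ψ.1.app_comp, hyx, Ψ.1.app_one]
    · have h2 : Ψ.1.app n ((Ψ⁻¹).1.app n θ) = θ := by
        rw [← EndHom.mul_app, Units.mul_inv, EndHom.one_app]
      rw [Units.val_mul, Units.val_mul, EndHom.mul_app, EndHom.mul_app, hΦ, P.app_plugAll,
        Ψ.1.app_comp, h2]

/-- The outer automorphism group. -/
abbrev OAut (P : SymOperad.{u, v} k) : Type v := P.AutGroup ⧸ P.IAut

/-! ## Ideals, quotients and truncations -/

/-- An (operadic) ideal: submodules of the `P n`, stable under the symmetric groups and under partial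
composition with arbitrary elements on either side. -/
structure OpIdeal (P : SymOperad.{u, v} k) where
  sub : ∀ n, Submodule k (P.obj n)
  act_mem : ∀ {n : ℕ} (σ : Equiv.Perm (Fin n)) (θ : P.obj n), θ ∈ sub n → P.act σ θ ∈ sub n
  comp_mem_left : ∀ {m n r : ℕ} (h : r + 1 = m + n) (i : Fin m) (μ : P.obj m) (ν : P.obj n),
    μ ∈ sub m → P.comp h i μ ν ∈ sub r
  comp_mem_right : ∀ {m n r : ℕ} (h : r + 1 = m + n) (i : Fin m) (μ : P.obj m) (ν : P.obj n),
    ν ∈ sub n → P.comp h i μ ν ∈ sub r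

/-- The composition induced on the quotient by an ideal. -/
def quotComp (P : SymOperad.{u, v} k) (I : P.OpIdeal) {m n r : ℕ} (h : r + 1 = m + n) (i : Fin m) :
    (P.obj m ⧸ I.sub m) →ₗ[k] (P.obj n ⧸ I.sub n) →ₗ[k] (P.obj r ⧸ I.sub r) :=
  LinearMap.flip <| (I.sub n).liftQ
    (LinearMap.flip <| (I.sub m).liftQ ((P.comp h i).compr₂ (I.sub r).mkQ) (by
      intro μ hμ
      ext ν
      simpa using I.comp_mem_left h i μ ν hμ)) (by
    intro ν hν
    ext μ
    exact (Submodule.Quotient.mk_eq_zero _).mpr (I.comp_mem_right h i μ ν hν))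

theorem quotComp_mk (P : SymOperad.{u, v} k) (I : P.OpIdeal) {m n r : ℕ} (h : r + 1 = m + n)
    (i : Fin m) (μ : P.obj m) (ν : P.obj n) :
    P.quotComp I h i (Submodule.Quotient.mk μ) (Submodule.Quotient.mk ν) =
      Submodule.Quotient.mk (P.comp h i μ ν) := rfl

/-- The quotient operad `P / I`. -/
def quot (P : SymOperad.{u, v} k) (I : P.OpIdeal) : SymOperad.{u, v} k where
  obj n := P.obj n ⧸ I.sub n
  act {n} σ := (I.sub n).mapQ (I.sub n) (P.act σ) (fun θ hθ => I.act_mem σ θ hθ)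
  one := Submodule.Quotient.mk P.one
  comp h i := P.quotComp I h i
  act_one θ := by
    obtain ⟨θ, rfl⟩ := Submodule.Quotient.mk_surjective _ θ
    simp [P.act_one]
  act_mul σ τ θ := by
    obtain ⟨θ, rfl⟩ := Submodule.Quotient.mk_surjective _ θ
    simp [P.act_mul]
  comp_one h i θ := by
    obtain ⟨θ, rfl⟩ := Submodule.Quotient.mk_surjective _ θ
    rw [quotComp_mk, P.comp_one]
  one_comp h θ := by
    obtain ⟨θ, rfl⟩ := Submodule.Quotient.mk_surjective _ θ
    rw [quotComp_mk, P.one_comp]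
  assoc h₁ h₂ h₃ h₄ i j q hq α β γ := by
    obtain ⟨α, rfl⟩ := Submodule.Quotient.mk_surjective _ α
    obtain ⟨β, rfl⟩ := Submodule.Quotient.mk_surjective _ β
    obtain ⟨γ, rfl⟩ := Submodule.Quotient.mk_surjective _ γ
    simp only [quotComp_mk]
    rw [P.assoc h₁ h₂ h₃ h₄ i j q hq]
  comm h₁ h₂ h₃ h₄ i c hic q hq q' hq' α β γ := by
    obtain ⟨α, rfl⟩ := Submodule.Quotient.mk_surjective _ α
    obtain ⟨β, rfl⟩ := Submodule.Quotient.mk_surjective _ β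
    obtain ⟨γ, rfl⟩ := Submodule.Quotient.mk_surjective _ γ
    simp only [quotComp_mk]
    rw [P.comm h₁ h₂ h₃ h₄ i c hic q hq q' hq']
  comp_act h i μ ν σ := by
    obtain ⟨μ, rfl⟩ := Submodule.Quotient.mk_surjective _ μ
    obtain ⟨ν, rfl⟩ := Submodule.Quotient.mk_surjective _ ν
    simp only [Submodule.mapQ_apply, quotComp_mk]
    rw [P.comp_act]
  act_comp h i μ ν φ := by
    obtain ⟨μ, rfl⟩ := Submodule.Quotient.mk_surjective _ μ
    obtain ⟨ν, rfl⟩ := Submodule.Quotient.mk_surjective _ ν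
    simp only [Submodule.mapQ_apply, quotComp_mk]
    rw [P.act_comp]

/-- `1₁ = 1` and `1₀ = u`, indexed by the truth value of membership in a subset. -/
def unitAt (P : SymOperad.{u, v} k) (u : P.obj 0) : (b : Bool) → P.obj b.toNat
  | true => P.one
  | false => u

/-- The restriction operator `π^I : P n → P |I|`, `θ ↦ θ ∘ (1_{χ(1)}, …, 1_{χ(n)})`, where `χ` is the
characteristic function of the subset `I` of the set of inputs and `u = 1₀` is the `0`-unit. -/
def restr (P : SymOperad.{u, v} k) (u : P.obj 0) {n s : ℕ} (χ : Fin n → Bool)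
    (h : ∑ i, (χ i).toNat = s) : P.obj n →ₗ[k] P.obj s :=
  P.compAll (fun i => (χ i).toNat) (fun i => P.unitAt u (χ i)) h

/-- The arity `n` part of the `K`-th truncation ideal: for `n ≥ K` the intersection of the kernels of
the restriction operators `π^I` over all `I` with `|I| = K - 1`, and `0` for `n < K`.
For `K = 0` the intersection is empty, so that one gets all of `P`. -/
def truncSub (P : SymOperad.{u, v} k) (u : P.obj 0) (K n : ℕ) : Submodule k (P.obj n) :=
  if K ≤ n then
    ⨅ (s : ℕ) (_ : s + 1 = K) (χ : Fin n → Bool) (h : ∑ i, (χ i).toNat = s),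
      LinearMap.ker (P.restr u χ h)
  else ⊥

theorem mem_truncSub_of_lt (P : SymOperad.{u, v} k) (u : P.obj 0) {K n : ℕ} (h : n < K)
    (θ : P.obj n) : θ ∈ P.truncSub u K n ↔ θ = 0 := by
  simp [truncSub, Nat.not_le.mpr h]

theorem mem_truncSub (P : SymOperad.{u, v} k) (u : P.obj 0) {K n : ℕ} (hK : K ≤ n)
    (θ : P.obj n) : θ ∈ P.truncSub u K n ↔
      ∀ (s : ℕ) (_ : s + 1 = K) (χ : Fin n → Bool) (h : ∑ i, (χ i).toNat = s),
        P.restr u χ h θ = 0 := by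
  simp [truncSub, hK, Submodule.mem_iInf]

theorem comp_unitAt_false (P : SymOperad.{u, v} k) (u : P.obj 0) {N N' : ℕ} (b : Bool)
    (hb : b = false) (hN : N' + 1 = N + b.toNat) (hN' : N' + 1 = N + 0) (i : Fin N)
    (θ : P.obj N) : P.comp hN i θ (P.unitAt u b) = P.comp hN' i θ u := by
  subst hb
  rfl

theorem compAux_insert (P : SymOperad.{u, v} k) (u : P.obj 0) (t : ℕ) {N N' r : ℕ}
    (hN : N' + 1 = N + 0) (ht : t + 1 ≤ N) (ht' : t ≤ N') (χ : Fin (t + 1) → Bool)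
    (χ' : Fin t → Bool) (i : Fin (t + 1)) (hi : χ i = false)
    (hχ : ∀ j, χ' j = χ (i.succAbove j)) (h : r + (t + 1) = N + ∑ i, (χ i).toNat)
    (h' : r + t = N' + ∑ i, (χ' i).toNat) (p : Fin N) (hp : p.1 = i.1) (θ : P.obj N) :
    P.compAux (t + 1) (fun i => (χ i).toNat) (fun i => P.unitAt u (χ i)) ht h θ =
      P.compAux t (fun i => (χ' i).toNat) (fun i => P.unitAt u (χ' i)) ht' h'
        (P.comp hN p θ u) := by
  induction t generalizing N N' with
  | zero =>
    obtain rfl : i = Fin.last 0 := Fin.ext (by have := i.2; simp)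
    obtain rfl : χ' = fun j => χ j.castSucc := funext fun j => j.elim0
    obtain rfl : p = ⟨0, ht⟩ := Fin.ext hp
    rw [P.compAux_succ (N' := N') _ _ ht h (by rw [hi]; exact hN) ht' h',
      P.comp_unitAt_false u _ hi _ hN]
  | succ t ih =>
    rcases Fin.eq_castSucc_or_eq_last i with ⟨i, rfl⟩ | rfl
    · have hlast : χ' (Fin.last t) = χ (Fin.last (t + 1)) := by
        rw [hχ, Fin.succAbove_of_le_castSucc, Fin.succ_last]
        exact Fin.le_last i
      have h0 : ∀ j : Fin t, χ' j.castSucc = χ (i.succAbove j).castSucc := by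
        intro j
        rw [hχ, Fin.castSucc_succAbove_castSucc]
      have hs := Fin.sum_univ_castSucc (fun i => (χ i).toNat)
      have hs' := Fin.sum_univ_castSucc (fun i => (χ' i).toNat)
      have e1 := P.compAux_succ (N' := N + (χ (Fin.last (t + 1))).toNat - 1) (fun i => (χ i).toNat)
        (fun i => P.unitAt u (χ i)) ht h (by omega) (by omega) (by omega) θ
      have e2 := P.compAux_succ (N' := N' + (χ' (Fin.last t)).toNat - 1) (fun i => (χ' i).toNat)
        (fun i => P.unitAt u (χ' i)) ht' h' (by omega) (by omega) (by omega) (P.comp hN p θ u)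
      have hp' : p.1 = i.1 := hp
      have hit := i.2
      have g1 : N' + (χ' (Fin.last t)).toNat - 1 + 1 = N + (χ (Fin.last (t + 1))).toNat - 1 + 0 := by
        rw [hlast]
        omega
      have g2 : r + (t + 1) = N + (χ (Fin.last (t + 1))).toNat - 1 +
          ∑ i : Fin (t + 1), (χ i.castSucc).toNat := by omega
      have g3 : r + t = N' + (χ' (Fin.last t)).toNat - 1 +
          ∑ i : Fin t, (χ' i.castSucc).toNat := by omega
      rw [e1, e2]
      refine (ih g1 (by omega) (by omega) (fun j => χ j.castSucc) (fun j => χ' j.castSucc) i hi h0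
        g2 g3 ⟨i.1, by omega⟩ rfl _).trans ?_
      congr 1
      have key : ∀ (b b' : Bool), b' = b → ∀ (M : ℕ) (g1 : M + 1 = (N + b.toNat - 1) + 0)
          (g2 : N + b.toNat - 1 + 1 = N + b.toNat) (g3 : M + 1 = N' + b'.toNat)
          (j1 : Fin (N + b.toNat - 1)) (_ : j1.1 = i.1) (j2 : Fin N) (_ : j2.1 = t + 1)
          (j3 : Fin N') (_ : j3.1 = t),
          P.comp g1 j1 (P.comp g2 j2 θ (P.unitAt u b)) u =
            P.comp g3 j3 (P.comp hN p θ u) (P.unitAt u b') := by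
        intro b b' hb M g1 g2 g3 j1 hj1 j2 hj2 j3 hj3
        subst hb
        exact (P.comm hN g3 g2 g1 p j2 (by omega) j3 (by omega) j1 (by omega) θ u _).symm
      exact key _ _ hlast _ _ _ _ _ rfl _ rfl _ rfl
    · obtain rfl : χ' = fun j => χ j.castSucc := funext fun j => by
        rw [hχ, Fin.succAbove_last]
      obtain rfl : p = ⟨t + 1, ht⟩ := Fin.ext hp
      rw [P.compAux_succ (N' := N') _ _ ht h (by rw [hi]; exact hN) ht' h',
        P.comp_unitAt_false u _ hi _ hN]

theorem restr_true (P : SymOperad.{u, v} k) (u : P.obj 0) {n : ℕ}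
    (h : ∑ _i : Fin n, Bool.toNat true = n) (θ : P.obj n) :
    P.restr u (fun _ => true) h θ = θ :=
  P.plugAll_one n θ

/-- Recursive description of the truncation ideals. -/
theorem mem_truncSub_succ (P : SymOperad.{u, v} k) (u : P.obj 0) {K n : ℕ} (hK : K ≤ n + 1)
    (θ : P.obj (n + 1)) :
    θ ∈ P.truncSub u K (n + 1) ↔
      ∀ i : Fin (n + 1), P.comp (r := n) (by omega) i θ u ∈ P.truncSub u K n := by
  have ins : ∀ (s : ℕ) (χ : Fin (n + 1) → Bool) (χ' : Fin n → Bool) (i : Fin (n + 1)),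
      χ i = false → (∀ j, χ' j = χ (i.succAbove j)) → ∀ (h : ∑ i, (χ i).toNat = s)
      (h' : ∑ i, (χ' i).toNat = s), P.restr u χ h θ = P.restr u χ' h' (P.comp (r := n) (by omega) i θ u) := by
    intro s χ χ' i hi hχ h h'
    exact P.compAux_insert u n (by omega) le_rfl le_rfl χ χ' i hi hχ (by omega) (by omega) i rfl θ
  rw [P.mem_truncSub u hK]
  constructor
  · intro hθ i
    have main : ∀ (s : ℕ) (_ : s + 1 = K) (χ' : Fin n → Bool) (h' : ∑ i, (χ' i).toNat = s),
        P.restr u χ' h' (P.comp (r := n) (by omega) i θ u) = 0 := by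
      intro s hs χ' h'
      rw [← ins s (i.insertNth false χ') χ' i (by simp) (by simp)
        (by rw [Fin.sum_univ_succAbove _ i]; simpa using h') h']
      exact hθ s hs _ _
    rcases Nat.lt_or_ge n K with hn | hn
    · rw [P.mem_truncSub_of_lt u hn]
      have := main n (by omega) (fun _ => true) (by simp)
      rwa [P.restr_true] at this
    · rwa [P.mem_truncSub u hn]
  · intro hθ s hs χ h
    obtain ⟨i, hi⟩ : ∃ i, χ i = false := by
      by_contra hcon
      have hall : ∀ i, χ i = true := fun i => by
        cases hc : χ i
        · exact absurd ⟨i, hc⟩ hcon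
        · rfl
      simp [hall] at h
      omega
    have h' : ∑ j, (χ (i.succAbove j)).toNat = s := by
      rw [Fin.sum_univ_succAbove _ i, hi] at h
      simpa using h
    rw [ins s χ (fun j => χ (i.succAbove j)) i hi (fun _ => rfl) h h']
    rcases Nat.lt_or_ge n K with hn | hn
    · rw [(P.mem_truncSub_of_lt u hn _).mp (hθ i), map_zero]
    · exact (P.mem_truncSub u hn _).mp (hθ i) s hs _ _

/-- Inserting an arity `0` element into a partial composite. -/
theorem comp_comp_unit (P : SymOperad.{u, v} k) (u : P.obj 0) {m n r : ℕ}
    (h : r + 1 + 1 = m + n) (i : Fin m) (p : Fin (r + 1)) (μ : P.obj m) (ν : P.obj n)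
    {C : P.obj r → Prop}
    (h1 : ∀ (n' : ℕ) (hn : n = n' + 1) (hr : r + 1 = m + n') (j : Fin n),
      C (P.comp hr i μ (P.comp (by omega) j ν u)))
    (h2 : ∀ (m' : ℕ) (hm : m = m' + 1) (hr : r + 1 = m' + n) (q : Fin m) (i' : Fin m'),
      C (P.comp hr i' (P.comp (by omega) q μ u) ν)) :
    C (P.comp (r := r) (by omega) p (P.comp h i μ ν) u) := by
  have hi := i.2
  have hp := p.2
  rcases Nat.lt_or_ge p.1 i.1 with hpi | hpi
  · have e := P.comm (a := m - 1) (s := r) (b := r + 1) (by omega) (by omega) h rfl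
      ⟨p.1, by omega⟩ i hpi ⟨i.1 - 1, by omega⟩ (by simp; omega) p rfl μ u ν
    rw [← e]
    exact h2 (m - 1) (by omega) (by omega) _ _
  · rcases Nat.lt_or_ge p.1 (i.1 + n) with hpn | hpn
    · have e := P.assoc (b := n - 1) (s := r) h rfl (by omega) (by omega) i
        ⟨p.1 - i.1, by omega⟩ p (by simp; omega) μ ν u
      rw [e]
      exact h1 (n - 1) (by omega) (by omega) _
    · have e := P.comm (a := r + 1) (s := r) (b := m - 1) h rfl (by omega) (by omega)
        i ⟨p.1 + 1 - n, by omega⟩ (by simp; omega) p (by simp; omega) ⟨i.1, by omega⟩ rfl μ ν u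
      rw [e]
      exact h2 (m - 1) (by omega) (by omega) _ _

theorem truncSub_zero (P : SymOperad.{u, v} k) (u : P.obj 0) (n : ℕ) : P.truncSub u 0 n = ⊤ := by
  simp [truncSub]

/-- The `K`-th truncation ideal of an operad with `P 0` spanned by the `0`-unit `u = 1₀`. -/
def truncIdeal (P : SymOperad.{u, v} k) (u : P.obj 0) (hu : ∀ x : P.obj 0, ∃ c : k, x = c • u)
    (K : ℕ) : P.OpIdeal where
  sub := P.truncSub u K
  act_mem {n} σ θ hθ := by
    rcases Nat.eq_zero_or_pos K with rfl | hK
    · simp [truncSub_zero]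
    induction n with
    | zero =>
      rw [P.mem_truncSub_of_lt u hK] at hθ ⊢
      simp [hθ]
    | succ n ih =>
      rcases Nat.lt_or_ge (n + 1) K with hn | hn
      · rw [P.mem_truncSub_of_lt u hn] at hθ ⊢
        simp [hθ]
      · rw [P.mem_truncSub_succ u hn] at hθ ⊢
        intro i
        rw [P.act_comp]
        exact ih _ _ (hθ _)
  comp_mem_left {m n r} h i μ ν hμ := by
    rcases Nat.eq_zero_or_pos K with rfl | hK
    · simp [truncSub_zero]
    induction r generalizing m n with
    | zero =>
      obtain ⟨rfl, rfl⟩ : m = 1 ∧ n = 0 := by have := i.2; omega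
      obtain ⟨c, rfl⟩ := hu ν
      rw [map_smul]
      refine Submodule.smul_mem _ _ ?_
      rcases Nat.lt_or_ge 1 K with h1 | h1
      · rw [P.mem_truncSub_of_lt u h1] at hμ
        simp [hμ]
      · exact (P.mem_truncSub_succ u h1 μ).mp hμ i
    | succ r ih =>
      rcases Nat.lt_or_ge m K with hm | hm
      · rw [P.mem_truncSub_of_lt u hm] at hμ
        simp [hμ]
      rcases Nat.lt_or_ge (r + 1) K with hr | hr
      · obtain rfl : n = 0 := by omega
        obtain rfl : m = r + 1 + 1 := by omega
        obtain ⟨c, rfl⟩ := hu ν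
        rw [map_smul]
        exact Submodule.smul_mem _ _ ((P.mem_truncSub_succ u hm μ).mp hμ i)
      · rw [P.mem_truncSub_succ u hr]
        intro p
        refine P.comp_comp_unit u h i p μ ν (C := fun x => x ∈ P.truncSub u K r) ?_ ?_
        · intro n' hn hr' j
          exact ih _ _ _ _ hμ
        · rintro m' rfl hr' q i'
          exact ih _ _ _ _ ((P.mem_truncSub_succ u hm μ).mp hμ q)
  comp_mem_right {m n r} h i μ ν hν := by
    rcases Nat.eq_zero_or_pos K with rfl | hK
    · simp [truncSub_zero]
    induction r generalizing m n with
    | zero =>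
      obtain ⟨rfl, rfl⟩ : m = 1 ∧ n = 0 := by have := i.2; omega
      rw [P.mem_truncSub_of_lt u hK] at hν
      simp [hν]
    | succ r ih =>
      rcases Nat.lt_or_ge n K with hn | hn
      · rw [P.mem_truncSub_of_lt u hn] at hν
        simp [hν]
      · rw [P.mem_truncSub_succ u (by have := i.2; omega)]
        intro p
        refine P.comp_comp_unit u h i p μ ν (C := fun x => x ∈ P.truncSub u K r) ?_ ?_
        · rintro n' rfl hr' j
          exact ih _ _ _ _ ((P.mem_truncSub_succ u hn ν).mp hν j)
        · intro m' hm hr' q i'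
          exact ih _ _ _ _ hν

/-- `θ` becomes a multiple of `u = 1₀` when `u` is plugged into all the inputs of `θ`. -/
def Collapses (P : SymOperad.{u, v} k) (u : P.obj 0) : (n : ℕ) → P.obj n → Prop
  | 0, θ => ∃ c : k, θ = c • u
  | n + 1, θ => ∀ i : Fin (n + 1), Collapses P u n (P.comp (r := n) (by omega) i θ u)

theorem Collapses.add (P : SymOperad.{u, v} k) (u : P.obj 0) {n : ℕ} {x y : P.obj n}
    (hx : P.Collapses u n x) (hy : P.Collapses u n y) : P.Collapses u n (x + y) := by
  induction n with
  | zero =>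
    obtain ⟨c, rfl⟩ := hx
    obtain ⟨d, rfl⟩ := hy
    exact ⟨c + d, (add_smul _ _ _).symm⟩
  | succ n ih =>
    intro i
    rw [map_add, LinearMap.add_apply]
    exact ih (hx i) (hy i)

theorem Collapses.smul (P : SymOperad.{u, v} k) (u : P.obj 0) {n : ℕ} (c : k) {x : P.obj n}
    (hx : P.Collapses u n x) : P.Collapses u n (c • x) := by
  induction n with
  | zero =>
    obtain ⟨d, rfl⟩ := hx
    exact ⟨c * d, smul_smul _ _ _⟩
  | succ n ih =>
    intro i
    rw [map_smul, LinearMap.smul_apply]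
    exact ih (hx i)

theorem Collapses.zero (P : SymOperad.{u, v} k) (u : P.obj 0) (n : ℕ) :
    P.Collapses u n (0 : P.obj n) := by
  induction n with
  | zero => exact ⟨0, (zero_smul _ _).symm⟩
  | succ n ih =>
    intro i
    simpa using ih

theorem Collapses.act (P : SymOperad.{u, v} k) (u : P.obj 0) {n : ℕ} (σ : Equiv.Perm (Fin n))
    {x : P.obj n} (hx : P.Collapses u n x) : P.Collapses u n (P.act σ x) := by
  induction n with
  | zero =>
    obtain rfl : σ = 1 := Subsingleton.elim _ _
    rwa [P.act_one]
  | succ n ih =>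
    intro i
    rw [P.act_comp]
    exact ih _ (hx _)

theorem Collapses.comp (P : SymOperad.{u, v} k) (u : P.obj 0) {m n r : ℕ} (h : r + 1 = m + n)
    (i : Fin m) {μ : P.obj m} {ν : P.obj n} (hμ : P.Collapses u m μ) (hν : P.Collapses u n ν) :
    P.Collapses u r (P.comp h i μ ν) := by
  induction r generalizing m n with
  | zero =>
    obtain ⟨rfl, rfl⟩ : m = 1 ∧ n = 0 := by have := i.2; omega
    obtain ⟨c, rfl⟩ := hν
    rw [map_smul]
    exact Collapses.smul P u c (hμ i)
  | succ r ih =>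
    intro p
    refine P.comp_comp_unit u h i p μ ν (C := fun x => P.Collapses u r x) ?_ ?_
    · rintro n' rfl hr' j
      exact ih _ _ hμ (hν j)
    · rintro m' rfl hr' q i'
      exact ih _ _ (hμ q) hν

end SymOperad

/-! ## The operad of unital associative algebras -/

namespace AsOperad

variable (k : Type u) [CommRing k]

/-- Bilinear extension of the partial composition of permutations. -/
noncomputable def comp {m n r : ℕ} (h : r + 1 = m + n) (i : Fin m) :
    (Equiv.Perm (Fin m) →₀ k) →ₗ[k] (Equiv.Perm (Fin n) →₀ k) →ₗ[k]
      (Equiv.Perm (Fin r) →₀ k) :=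
  Finsupp.lsum k fun φ =>
    LinearMap.toSpanSingleton k _ (Finsupp.lmapDomain k k (permComp h φ i))

theorem comp_single {m n r : ℕ} (h : r + 1 = m + n) (i : Fin m) (φ : Equiv.Perm (Fin m))
    (σ : Equiv.Perm (Fin n)) (a b : k) :
    comp k h i (Finsupp.single φ a) (Finsupp.single σ b) =
      Finsupp.single (permComp h φ i σ) (a * b) := by
  simp [comp]

/-- The operad `As` of unital associative algebras: `As n` is the free module `k S_n` on the
permutations of the `n` inputs, with right multiplication as the right action and with the bilinear
extension of the partial composition of permutations. -/
noncomputable def As : SymOperad.{u, u} k where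
  obj n := Equiv.Perm (Fin n) →₀ k
  act σ := Finsupp.lmapDomain k k (fun φ => φ * σ)
  one := Finsupp.single 1 1
  comp h i := comp k h i
  act_one θ := by
    induction θ using Finsupp.induction_linear with
    | zero => simp
    | add x y hx hy => simp only [map_add, hx, hy]
    | single φ a => simp
  act_mul σ τ θ := by
    induction θ using Finsupp.induction_linear with
    | zero => simp
    | add x y hx hy => simp only [map_add, hx, hy]
    | single φ a => simp [mul_assoc]
  comp_one h i θ := by
    induction θ using Finsupp.induction_linear with
    | zero => simp
    | add x y hx hy => simp only [map_add, LinearMap.add_apply, hx, hy]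
    | single φ a => rw [comp_single, permComp_one_right, mul_one]
  one_comp h θ := by
    induction θ using Finsupp.induction_linear with
    | zero => simp
    | add x y hx hy => simp only [map_add, hx, hy]
    | single φ a => rw [comp_single, permComp_one_left, one_mul]
  assoc h₁ h₂ h₃ h₄ i j q hq α β γ := by
    induction α using Finsupp.induction_linear with
    | zero => simp
    | add x y hx hy => simp only [map_add, LinearMap.add_apply, hx, hy]
    | single α a =>
      induction β using Finsupp.induction_linear with
      | zero => simp
      | add x y hx hy => simp only [map_add, LinearMap.add_apply, hx, hy]
      | single β b =>
        induction γ using Finsupp.induction_linear with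
        | zero => simp
        | add x y hx hy => simp only [map_add, hx, hy]
        | single γ c =>
          simp only [comp_single]
          rw [permComp_assoc h₁ h₂ h₃ h₄ i j q hq, mul_assoc]
  comm h₁ h₂ h₃ h₄ i c hic q hq q' hq' α β γ := by
    induction α using Finsupp.induction_linear with
    | zero => simp
    | add x y hx hy => simp only [map_add, LinearMap.add_apply, hx, hy]
    | single α a =>
      induction β using Finsupp.induction_linear with
      | zero => simp
      | add x y hx hy => simp only [map_add, LinearMap.add_apply, hx, hy]
      | single β b =>
        induction γ using Finsupp.induction_linear with
        | zero => simp
        | add x y hx hy => simp only [map_add, LinearMap.add_apply, hx, hy]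
        | single γ d =>
          simp only [comp_single]
          rw [permComp_comm h₁ h₂ h₃ h₄ i c hic q hq q' hq', mul_right_comm]
  comp_act h i μ ν σ := by
    induction μ using Finsupp.induction_linear with
    | zero => simp
    | add x y hx hy => simp only [map_add, LinearMap.add_apply, hx, hy]
    | single μ a =>
      induction ν using Finsupp.induction_linear with
      | zero => simp
      | add x y hx hy => simp only [map_add, hx, hy]
      | single ν b =>
        simp only [comp_single, Finsupp.lmapDomain_apply, Finsupp.mapDomain_single]
        have e := permComp_mul h μ 1 i ν σ
        rw [mul_one, Equiv.Perm.one_apply] at e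
        rw [e]
  act_comp h i μ ν φ := by
    induction μ using Finsupp.induction_linear with
    | zero => simp
    | add x y hx hy => simp only [map_add, LinearMap.add_apply, hx, hy]
    | single μ a =>
      induction ν using Finsupp.induction_linear with
      | zero => simp
      | add x y hx hy => simp only [map_add, hx, hy]
      | single ν b =>
        simp only [comp_single, Finsupp.lmapDomain_apply, Finsupp.mapDomain_single]
        have e := permComp_mul h μ φ i ν 1
        rw [mul_one] at e
        rw [e]

/-- The `0`-unit of `As`. -/
noncomputable def unit : (As k).obj 0 := Finsupp.single (1 : Equiv.Perm (Fin 0)) (1 : k)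

theorem unit_span (x : (As k).obj 0) : ∃ c : k, x = c • unit k := by
  refine ⟨(show Equiv.Perm (Fin 0) →₀ k from x) 1, ?_⟩
  apply Finsupp.ext
  intro σ
  obtain rfl : σ = 1 := Subsingleton.elim _ _
  change _ = ((show Equiv.Perm (Fin 0) →₀ k from x) 1 •
    (Finsupp.single (1 : Equiv.Perm (Fin 0)) (1 : k))) 1
  rw [Finsupp.smul_apply, Finsupp.single_eq_same, smul_eq_mul, mul_one]

/-- The quotient of `As` by its `K`-th truncation ideal. -/
noncomputable def AsTrunc (K : ℕ) : SymOperad.{u, u} k :=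
  (As k).quot ((As k).truncIdeal (unit k) (unit_span k) K)

end AsOperad

/-! ## Operads given by generators and relations -/

/-- Expressions of arity `n` in generators `X`, the operad operations, and `k`-linear
combinations. -/
inductive OpTerm (k : Type u) (X : ℕ → Type) : ℕ → Type u
  | gen {n : ℕ} (x : X n) : OpTerm k X n
  | one : OpTerm k X 1
  | zero (n : ℕ) : OpTerm k X n
  | add {n : ℕ} (a b : OpTerm k X n) : OpTerm k X n
  | smul {n : ℕ} (c : k) (a : OpTerm k X n) : OpTerm k X n
  | act {n : ℕ} (σ : Equiv.Perm (Fin n)) (a : OpTerm k X n) : OpTerm k X n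
  | comp {m n r : ℕ} (h : r + 1 = m + n) (i : Fin m) (a : OpTerm k X m) (b : OpTerm k X n) :
      OpTerm k X r

namespace OpTerm

variable {k : Type u} [CommRing k] {X : ℕ → Type}

/-- The congruence on expressions generated by the relations `R`, the module axioms, the linearity of
the operations and the operad axioms. -/
inductive Rel (R : ∀ n, OpTerm k X n → OpTerm k X n → Prop) :
    ∀ {n : ℕ}, OpTerm k X n → OpTerm k X n → Prop
  | of {n : ℕ} {a b : OpTerm k X n} : R n a b → Rel R a b
  | refl {n : ℕ} (a : OpTerm k X n) : Rel R a a
  | symm {n : ℕ} {a b : OpTerm k X n} : Rel R a b → Rel R b a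
  | trans {n : ℕ} {a b c : OpTerm k X n} : Rel R a b → Rel R b c → Rel R a c
  | add_congr {n : ℕ} {a a' b b' : OpTerm k X n} :
      Rel R a a' → Rel R b b' → Rel R (add a b) (add a' b')
  | smul_congr {n : ℕ} (c : k) {a a' : OpTerm k X n} : Rel R a a' → Rel R (smul c a) (smul c a')
  | act_congr {n : ℕ} (σ : Equiv.Perm (Fin n)) {a a' : OpTerm k X n} :
      Rel R a a' → Rel R (act σ a) (act σ a')
  | comp_congr {m n r : ℕ} (h : r + 1 = m + n) (i : Fin m) {a a' : OpTerm k X m}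
      {b b' : OpTerm k X n} : Rel R a a' → Rel R b b' → Rel R (comp h i a b) (comp h i a' b')
  | add_assoc {n : ℕ} (a b c : OpTerm k X n) : Rel R (add (add a b) c) (add a (add b c))
  | add_comm {n : ℕ} (a b : OpTerm k X n) : Rel R (add a b) (add b a)
  | zero_add {n : ℕ} (a : OpTerm k X n) : Rel R (add (zero n) a) a
  | zero_smul {n : ℕ} (a : OpTerm k X n) : Rel R (smul 0 a) (zero n)
  | one_smul {n : ℕ} (a : OpTerm k X n) : Rel R (smul 1 a) a
  | mul_smul {n : ℕ} (c d : k) (a : OpTerm k X n) : Rel R (smul (c * d) a) (smul c (smul d a))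
  | add_smul {n : ℕ} (c d : k) (a : OpTerm k X n) :
      Rel R (smul (c + d) a) (add (smul c a) (smul d a))
  | smul_add {n : ℕ} (c : k) (a b : OpTerm k X n) :
      Rel R (smul c (add a b)) (add (smul c a) (smul c b))
  | act_add {n : ℕ} (σ : Equiv.Perm (Fin n)) (a b : OpTerm k X n) :
      Rel R (act σ (add a b)) (add (act σ a) (act σ b))
  | act_smul {n : ℕ} (σ : Equiv.Perm (Fin n)) (c : k) (a : OpTerm k X n) :
      Rel R (act σ (smul c a)) (smul c (act σ a))
  | comp_add {m n r : ℕ} (h : r + 1 = m + n) (i : Fin m) (a : OpTerm k X m) (b b' : OpTerm k X n) :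
      Rel R (comp h i a (add b b')) (add (comp h i a b) (comp h i a b'))
  | comp_smul {m n r : ℕ} (h : r + 1 = m + n) (i : Fin m) (c : k) (a : OpTerm k X m)
      (b : OpTerm k X n) : Rel R (comp h i a (smul c b)) (smul c (comp h i a b))
  | add_comp {m n r : ℕ} (h : r + 1 = m + n) (i : Fin m) (a a' : OpTerm k X m) (b : OpTerm k X n) :
      Rel R (comp h i (add a a') b) (add (comp h i a b) (comp h i a' b))
  | smul_comp {m n r : ℕ} (h : r + 1 = m + n) (i : Fin m) (c : k) (a : OpTerm k X m)
      (b : OpTerm k X n) : Rel R (comp h i (smul c a) b) (smul c (comp h i a b))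
  | act_one {n : ℕ} (a : OpTerm k X n) : Rel R (act 1 a) a
  | act_mul {n : ℕ} (σ τ : Equiv.Perm (Fin n)) (a : OpTerm k X n) :
      Rel R (act (σ * τ) a) (act τ (act σ a))
  | comp_one {n : ℕ} (h : n + 1 = n + 1) (i : Fin n) (a : OpTerm k X n) : Rel R (comp h i a one) a
  | one_comp {n : ℕ} (h : n + 1 = 1 + n) (a : OpTerm k X n) : Rel R (comp h 0 one a) a
  | assoc {l m n a b s : ℕ} (h₁ : a + 1 = l + m) (h₂ : s + 1 = a + n) (h₃ : b + 1 = m + n)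
      (h₄ : s + 1 = l + b) (i : Fin l) (j : Fin m) (q : Fin a) (hq : q.1 = i.1 + j.1)
      (α : OpTerm k X l) (β : OpTerm k X m) (γ : OpTerm k X n) :
      Rel R (comp h₂ q (comp h₁ i α β) γ) (comp h₄ i α (comp h₃ j β γ))
  | comm {l m n a b s : ℕ} (h₁ : a + 1 = l + m) (h₂ : s + 1 = a + n) (h₃ : b + 1 = l + n)
      (h₄ : s + 1 = b + m) (i c : Fin l) (hic : i.1 < c.1) (q : Fin a) (hq : q.1 + 1 = c.1 + m)
      (q' : Fin b) (hq' : q'.1 = i.1) (α : OpTerm k X l) (β : OpTerm k X m) (γ : OpTerm k X n) :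
      Rel R (comp h₂ q (comp h₁ i α β) γ) (comp h₄ q' (comp h₃ c α γ) β)
  | comp_act {m n r : ℕ} (h : r + 1 = m + n) (i : Fin m) (μ : OpTerm k X m) (ν : OpTerm k X n)
      (σ : Equiv.Perm (Fin n)) :
      Rel R (comp h i μ (act σ ν)) (act (permComp h 1 i σ) (comp h i μ ν))
  | act_comp {m n r : ℕ} (h : r + 1 = m + n) (i : Fin m) (μ : OpTerm k X m) (ν : OpTerm k X n)
      (φ : Equiv.Perm (Fin m)) :
      Rel R (comp h i (act φ μ) ν) (act (permComp h φ i 1) (comp h (φ i) μ ν))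

/-- The setoid of the congruence `Rel R` in arity `n`. -/
def relSetoid (R : ∀ n, OpTerm k X n → OpTerm k X n → Prop) (n : ℕ) : Setoid (OpTerm k X n) where
  r := Rel R
  iseqv := ⟨Rel.refl, Rel.symm, Rel.trans⟩

/-- The arity `n` component of the operad presented by generators `X` and relations `R`. -/
def PObj (R : ∀ n, OpTerm k X n → OpTerm k X n → Prop) (n : ℕ) : Type u := Quotient (relSetoid R n)

variable (R : ∀ n, OpTerm k X n → OpTerm k X n → Prop)

/-- The class of an expression. -/
def cls {n : ℕ} (a : OpTerm k X n) : PObj R n := Quotient.mk (relSetoid R n) a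

theorem cls_eq {n : ℕ} {a b : OpTerm k X n} (h : Rel R a b) : cls R a = cls R b :=
  Quotient.sound h

theorem cls_surj {n : ℕ} (x : PObj R n) : ∃ a, cls R a = x := Quotient.exists_rep x

instance (n : ℕ) : Add (PObj R n) where
  add := Quotient.map₂ add (fun _ _ h _ _ h' => Rel.add_congr h h')

instance (n : ℕ) : Zero (PObj R n) where
  zero := cls R (zero n)

instance (n : ℕ) : Neg (PObj R n) where
  neg := Quotient.map (smul (-1)) (fun _ _ h => Rel.smul_congr (-1) h)

instance (n : ℕ) : AddCommGroup (PObj R n) where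
  nsmul := nsmulRec
  zsmul := zsmulRec
  add_assoc := by
    rintro ⟨a⟩ ⟨b⟩ ⟨c⟩
    exact cls_eq R (Rel.add_assoc a b c)
  zero_add := by
    rintro ⟨a⟩
    exact cls_eq R (Rel.zero_add a)
  add_zero := by
    rintro ⟨a⟩
    exact cls_eq R ((Rel.add_comm _ _).trans (Rel.zero_add a))
  add_comm := by
    rintro ⟨a⟩ ⟨b⟩
    exact cls_eq R (Rel.add_comm a b)
  neg_add_cancel := by
    rintro ⟨a⟩
    refine cls_eq R ?_
    have h1 : Rel R (add (smul (-1) a) (smul 1 a)) (zero n) := by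
      refine (Rel.add_smul (-1) 1 a).symm.trans ?_
      rw [neg_add_cancel]
      exact Rel.zero_smul a
    exact (Rel.add_congr (Rel.refl _) (Rel.one_smul a).symm).trans h1

instance (n : ℕ) : SMul k (PObj R n) where
  smul c := Quotient.map (smul c) (fun _ _ h => Rel.smul_congr c h)

theorem cls_add {n : ℕ} (a b : OpTerm k X n) : cls R (add a b) = cls R a + cls R b := rfl

theorem cls_smul {n : ℕ} (c : k) (a : OpTerm k X n) : cls R (smul c a) = c • cls R a := rfl

theorem cls_zero (n : ℕ) : cls R (zero n) = 0 := rfl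

instance (n : ℕ) : Module k (PObj R n) :=
  Module.ofMinimalAxioms
    (by
      rintro c ⟨a⟩ ⟨b⟩
      exact cls_eq R (Rel.smul_add c a b))
    (by
      rintro c d ⟨a⟩
      exact cls_eq R (Rel.add_smul c d a))
    (by
      rintro c d ⟨a⟩
      exact cls_eq R (Rel.mul_smul c d a))
    (by
      rintro ⟨a⟩
      exact cls_eq R (Rel.one_smul a))

/-- The operad presented by generators `X` and relations `R`. -/
def presented : SymOperad.{u, u} k where
  obj n := PObj R n
  act σ :=
    { toFun := Quotient.map (act σ) (fun _ _ h => Rel.act_congr σ h)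
      map_add' := by
        rintro ⟨a⟩ ⟨b⟩
        exact cls_eq R (Rel.act_add σ a b)
      map_smul' := by
        rintro c ⟨a⟩
        exact cls_eq R (Rel.act_smul σ c a) }
  one := cls R one
  comp h i := LinearMap.mk₂ k
    (Quotient.map₂ (comp h i) (fun _ _ e _ _ e' => Rel.comp_congr h i e e'))
    (by
      rintro ⟨a⟩ ⟨a'⟩ ⟨b⟩
      exact cls_eq R (Rel.add_comp h i a a' b))
    (by
      rintro c ⟨a⟩ ⟨b⟩
      exact cls_eq R (Rel.smul_comp h i c a b))
    (by
      rintro ⟨a⟩ ⟨b⟩ ⟨b'⟩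
      exact cls_eq R (Rel.comp_add h i a b b'))
    (by
      rintro c ⟨a⟩ ⟨b⟩
      exact cls_eq R (Rel.comp_smul h i c a b))
  act_one := by
    rintro n ⟨a⟩
    exact cls_eq R (Rel.act_one a)
  act_mul := by
    rintro n σ τ ⟨a⟩
    exact cls_eq R (Rel.act_mul σ τ a)
  comp_one := by
    rintro n h i ⟨a⟩
    exact cls_eq R (Rel.comp_one h i a)
  one_comp := by
    rintro n h ⟨a⟩
    exact cls_eq R (Rel.one_comp h a)
  assoc := by
    rintro l m n a b s h₁ h₂ h₃ h₄ i j q hq ⟨α⟩ ⟨β⟩ ⟨γ⟩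
    exact cls_eq R (Rel.assoc h₁ h₂ h₃ h₄ i j q hq α β γ)
  comm := by
    rintro l m n a b s h₁ h₂ h₃ h₄ i c hic q hq q' hq' ⟨α⟩ ⟨β⟩ ⟨γ⟩
    exact cls_eq R (Rel.comm h₁ h₂ h₃ h₄ i c hic q hq q' hq' α β γ)
  comp_act := by
    rintro m n r h i ⟨μ⟩ ⟨ν⟩ σ
    exact cls_eq R (Rel.comp_act h i μ ν σ)
  act_comp := by
    rintro m n r h i ⟨μ⟩ ⟨ν⟩ φ
    exact cls_eq R (Rel.act_comp h i μ ν φ)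

theorem presented_comp {m n r : ℕ} (h : r + 1 = m + n) (i : Fin m) (a : OpTerm k X m)
    (b : OpTerm k X n) : (presented R).comp h i (cls R a) (cls R b) = cls R (comp h i a b) := rfl

end OpTerm

/-! ## The Lie operad and the operad of unital Poisson algebras -/

namespace LieOperad

/-- The generator of the Lie operad: a binary bracket. -/
inductive Gen : ℕ → Type
  | bracket : Gen 2

variable (k : Type u) [CommRing k]

open OpTerm in
/-- Antisymmetry `b * (12) = -b` and the Jacobi identity
`b ∘₂ b = b ∘₁ b + (b ∘₂ b) * (12)`. -/
inductive Relators : ∀ n, OpTerm k Gen n → OpTerm k Gen n → Prop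
  | antisymm : Relators 2 (act (Equiv.swap 0 1) (gen Gen.bracket)) (smul (-1) (gen Gen.bracket))
  | jacobi : Relators 3 (comp (by omega) 1 (gen Gen.bracket) (gen Gen.bracket))
      (add (comp (by omega) 0 (gen Gen.bracket) (gen Gen.bracket))
        (act (Equiv.swap 0 1) (comp (by omega) 1 (gen Gen.bracket) (gen Gen.bracket))))

/-- The Lie operad. -/
def Lie : SymOperad.{u, u} k := OpTerm.presented (Relators k)

end LieOperad

namespace PoisOperad

/-- The generators of the operad of unital Poisson algebras: the unit `1₀`, the commutative
product `1₂` and the bracket `b`. -/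
inductive Gen : ℕ → Type
  | unit : Gen 0
  | mul : Gen 2
  | bracket : Gen 2

variable (k : Type u) [CommRing k]

open OpTerm in
/-- The relations of unital commutative Poisson algebras. -/
inductive Relators : ∀ n, OpTerm k Gen n → OpTerm k Gen n → Prop
  /-- `1₂ ∘₁ 1₀ = 1` -/
  | unit_mul : Relators 1 (comp (by omega) 0 (gen Gen.mul) (gen Gen.unit)) one
  /-- `1₂ ∘₂ 1₀ = 1` -/
  | mul_unit : Relators 1 (comp (by omega) 1 (gen Gen.mul) (gen Gen.unit)) one
  /-- `b ∘₁ 1₀ = 0` -/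
  | unit_bracket : Relators 1 (comp (by omega) 0 (gen Gen.bracket) (gen Gen.unit)) (zero 1)
  /-- `b ∘₂ 1₀ = 0` -/
  | bracket_unit : Relators 1 (comp (by omega) 1 (gen Gen.bracket) (gen Gen.unit)) (zero 1)
  /-- `1₂ * (12) = 1₂` -/
  | mul_comm : Relators 2 (act (Equiv.swap 0 1) (gen Gen.mul)) (gen Gen.mul)
  /-- `b * (12) = -b` -/
  | antisymm : Relators 2 (act (Equiv.swap 0 1) (gen Gen.bracket)) (smul (-1) (gen Gen.bracket))
  /-- `1₂ ∘₁ 1₂ = 1₂ ∘₂ 1₂` -/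
  | mul_assoc : Relators 3 (comp (by omega) 0 (gen Gen.mul) (gen Gen.mul))
      (comp (by omega) 1 (gen Gen.mul) (gen Gen.mul))
  /-- `b ∘₁ 1₂ = 1₂ ∘₂ b + (1₂ ∘₂ b) * (12)` -/
  | leibniz : Relators 3 (comp (by omega) 0 (gen Gen.bracket) (gen Gen.mul))
      (add (comp (by omega) 1 (gen Gen.mul) (gen Gen.bracket))
        (act (Equiv.swap 0 1) (comp (by omega) 1 (gen Gen.mul) (gen Gen.bracket))))
  /-- `b ∘₂ b = b ∘₁ b + (b ∘₂ b) * (12)` -/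
  | jacobi : Relators 3 (comp (by omega) 1 (gen Gen.bracket) (gen Gen.bracket))
      (add (comp (by omega) 0 (gen Gen.bracket) (gen Gen.bracket))
        (act (Equiv.swap 0 1) (comp (by omega) 1 (gen Gen.bracket) (gen Gen.bracket))))

/-- The operad `Pois` of unital commutative Poisson algebras. -/
def Pois : SymOperad.{u, u} k := OpTerm.presented (Relators k)

/-- The `0`-unit of `Pois`. -/
def unit : (Pois k).obj 0 := OpTerm.cls (Relators k) (OpTerm.gen Gen.unit)

open OpTerm in
theorem collapses {n : ℕ} (a : OpTerm k Gen n) :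
    (Pois k).Collapses (unit k) n (cls (Relators k) a) := by
  induction a with
  | gen x =>
    cases x with
    | unit => exact ⟨1, (one_smul _ _).symm⟩
    | mul =>
      intro i j
      obtain rfl : j = 0 := Fin.ext (by have := j.2; simp)
      refine ⟨1, ?_⟩
      have key : (Pois k).comp (m := 2) (n := 0) (r := 1) rfl i (cls (Relators k) (gen Gen.mul)) (unit k) =
          (Pois k).one := by
        fin_cases i
        · exact cls_eq _ (Rel.of Relators.unit_mul)
        · exact cls_eq _ (Rel.of Relators.mul_unit)
      rw [key, (Pois k).one_comp, one_smul]
    | bracket =>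
      intro i j
      obtain rfl : j = 0 := Fin.ext (by have := j.2; simp)
      refine ⟨0, ?_⟩
      have key : (Pois k).comp (m := 2) (n := 0) (r := 1) rfl i (cls (Relators k) (gen Gen.bracket)) (unit k) = 0 := by
        fin_cases i
        · exact cls_eq _ (Rel.of Relators.unit_bracket)
        · exact cls_eq _ (Rel.of Relators.bracket_unit)
      rw [key, map_zero, LinearMap.zero_apply, zero_smul]
  | one =>
    intro j
    obtain rfl : j = 0 := Fin.ext (by have := j.2; simp)
    exact ⟨1, ((Pois k).one_comp _ _).trans (one_smul _ _).symm⟩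
  | zero n => exact SymOperad.Collapses.zero _ _ n
  | add a b ha hb => exact SymOperad.Collapses.add _ _ ha hb
  | smul c a ha => exact SymOperad.Collapses.smul _ _ c ha
  | act σ a ha => exact SymOperad.Collapses.act _ _ σ ha
  | comp h i a b ha hb => exact SymOperad.Collapses.comp _ _ h i ha hb

theorem unit_span (x : (Pois k).obj 0) : ∃ c : k, x = c • unit k := by
  obtain ⟨a, rfl⟩ := OpTerm.cls_surj (Relators k) x
  exact collapses k a

/-- The quotient of `Pois` by its `K`-th truncation ideal. -/
def PoisTrunc (K : ℕ) : SymOperad.{u, u} k :=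
  (Pois k).quot ((Pois k).truncIdeal (unit k) (unit_span k) K)

end PoisOperad

/-!
An endomorphism is determined by its values on the generators, and these satisfy the defining
relations.

* For `As`, the unit `e` goes to `u e` and the product `m` to an associative combination
  `a m + b mᵒᵖ`. Unitality gives `u (a + b) = 1` and associativity, in arity `3`, gives `a b = 0`.
  Hence `u a` is idempotent, so that `m` goes to `a m` or to `b mᵒᵖ`.
* For `Lie`, the bracket goes to a multiple of itself, and every multiple occurs.
* For `Pois`, the bracket `β` goes to a multiple of itself, the unit to `u e` and the product to
  `x m + y β` with `u x = 1` and `2 y = 0`. Associativity, in arity `3`, gives `y² = 0`.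

Only the components of arity at most `3` intervene, and these survive in the truncations, with the
exception of `Pois / ³I`, where the relation `y² = 0` is lost. That the relations of `Lie` and
`Pois` impose nothing more on these components is seen from the images in the symbols of
polydifferential operators on the plane: the product has the symbol `1` and the bracket the symbol
`ξ₁ η₂ - ξ₂ η₁`.
-/

universe w

namespace SymOperad

variable {k : Type u} [CommRing k] {P : SymOperad.{u, v} k} {Q : SymOperad.{u, w} k}

/-! ## Morphisms -/

/-- A morphism of symmetric operads: a family of linear maps preserving the identity, the symmetric
group actions and the partial compositions. -/
@[ext]
structure Hom (P : SymOperad.{u, v} k) (Q : SymOperad.{u, w} k) where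
  app : ∀ n, P.obj n →ₗ[k] Q.obj n
  app_one : app 1 P.one = Q.one
  app_act : ∀ {n : ℕ} (σ : Equiv.Perm (Fin n)) (θ : P.obj n),
    app n (P.act σ θ) = Q.act σ (app n θ)
  app_comp : ∀ {m n r : ℕ} (h : r + 1 = m + n) (i : Fin m) (μ : P.obj m) (ν : P.obj n),
    app r (P.comp h i μ ν) = Q.comp h i (app m μ) (app n ν)

/-- The identity morphism. -/
def Hom.id (P : SymOperad.{u, v} k) : Hom P P where
  app _ := LinearMap.id
  app_one := rfl
  app_act _ _ := rfl
  app_comp _ _ _ _ := rfl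

/-- A morphism from an operad to itself, regarded as an endomorphism. -/
def Hom.toEndHom (f : Hom P P) : P.EndHom where
  app := f.app
  app_one := f.app_one
  app_act := f.app_act
  app_comp := f.app_comp

/-- Postcomposition of a morphism with an endomorphism of its target. -/
def EndHom.compHom (Φ : Q.EndHom) (f : Hom P Q) : Hom P Q where
  app n := Φ.app n ∘ₗ f.app n
  app_one := by rw [LinearMap.comp_apply, f.app_one, Φ.app_one]
  app_act σ θ := by simp only [LinearMap.comp_apply, f.app_act, Φ.app_act]
  app_comp h i μ ν := by simp only [LinearMap.comp_apply, f.app_comp, Φ.app_comp]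

theorem Hom.ext_app {f g : Hom P Q} (h : ∀ n θ, f.app n θ = g.app n θ) : f = g :=
  Hom.ext (funext fun n => LinearMap.ext (h n))

theorem EndHom.ext_app {Φ Ψ : P.EndHom} (h : ∀ n θ, Φ.app n θ = Ψ.app n θ) : Φ = Ψ :=
  EndHom.ext (funext fun n => LinearMap.ext (h n))

theorem EndHom.eq_of_compHom_eq {f : Hom P Q} (hf : ∀ n, Function.Surjective (f.app n))
    {Φ Ψ : Q.EndHom} (h : Φ.compHom f = Ψ.compHom f) : Φ = Ψ :=
  EndHom.ext_app fun n => (hf n).forall.2 fun θ => congrArg (fun g : Hom P Q => g.app n θ) h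

theorem Hom.injective_smul_one (f : Hom P Q) (h : Function.Injective fun c : k => c • Q.one) :
    Function.Injective fun c : k => c • P.one := fun c d hcd => h <| by
  simpa only [map_smul, f.app_one] using congrArg (f.app 1) hcd

/-! ## Binary operations -/

/-- The partial compositions of two binary operations. -/
abbrev comp₂₂ (P : SymOperad.{u, v} k) (i : Fin 2) : P.obj 2 →ₗ[k] P.obj 2 →ₗ[k] P.obj 3 :=
  P.comp rfl i

/-- The insertion of a constant into a binary operation. -/
abbrev comp₂₀ (P : SymOperad.{u, v} k) (i : Fin 2) : P.obj 2 →ₗ[k] P.obj 0 →ₗ[k] P.obj 1 :=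
  P.comp rfl i

theorem Hom.app_comp₂₂ (f : Hom P Q) (i : Fin 2) (x y : P.obj 2) :
    f.app 3 (P.comp₂₂ i x y) = Q.comp₂₂ i (f.app 2 x) (f.app 2 y) :=
  f.app_comp _ i x y

theorem Hom.app_comp₂₀ (f : Hom P Q) (i : Fin 2) (x : P.obj 2) (y : P.obj 0) :
    f.app 1 (P.comp₂₀ i x y) = Q.comp₂₀ i (f.app 2 x) (f.app 0 y) :=
  f.app_comp _ i x y

/-- A binary operation `x` is associative if `x ∘₁ x = x ∘₂ x`. -/
def IsAssociative (P : SymOperad.{u, v} k) (x : P.obj 2) : Prop :=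
  P.comp₂₂ 0 x x = P.comp₂₂ 1 x x

theorem IsAssociative.map {x : P.obj 2} (hx : P.IsAssociative x) (f : Hom P Q) :
    Q.IsAssociative (f.app 2 x) := by
  rw [IsAssociative, ← f.app_comp₂₂, ← f.app_comp₂₂, hx]

theorem IsAssociative.of_map {f : Hom P Q} (hf : Function.Injective (f.app 3)) {x : P.obj 2}
    (hx : Q.IsAssociative (f.app 2 x)) : P.IsAssociative x :=
  hf (by rw [f.app_comp₂₂, f.app_comp₂₂, hx])

/-- A binary operation `b` is a Lie bracket if it is antisymmetric and satisfies the Jacobi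
identity, in the form of the relations defining `Lie`. -/
structure IsLieBracket (P : SymOperad.{u, v} k) (b : P.obj 2) : Prop where
  antisymm : P.act (Equiv.swap 0 1) b = -b
  jacobi : P.comp₂₂ 1 b b = P.comp₂₂ 0 b b + P.act (Equiv.swap 0 1) (P.comp₂₂ 1 b b)

/-- Operations `e`, `m`, `b` form a Poisson structure if they satisfy the relations defining `Pois`,
with `e` as the unit, `m` as the product and `b` as the bracket. -/
structure IsPoisson (P : SymOperad.{u, v} k) (e : P.obj 0) (m b : P.obj 2) : Prop
    extends P.IsLieBracket b where
  mul_unit : ∀ i, P.comp₂₀ i m e = P.one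
  bracket_unit : ∀ i, P.comp₂₀ i b e = 0
  mul_comm : P.act (Equiv.swap 0 1) m = m
  mul_assoc : P.IsAssociative m
  leibniz : P.comp₂₂ 0 b m = P.comp₂₂ 1 m b + P.act (Equiv.swap 0 1) (P.comp₂₂ 1 m b)

theorem IsLieBracket.map {b : P.obj 2} (hb : P.IsLieBracket b) (f : Hom P Q) :
    Q.IsLieBracket (f.app 2 b) where
  antisymm := by rw [← f.app_act, hb.antisymm, map_neg]
  jacobi := by simp only [← f.app_comp₂₂, ← f.app_act, ← map_add, ← hb.jacobi]

theorem IsLieBracket.smul {b : P.obj 2} (hb : P.IsLieBracket b) (c : k) :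
    P.IsLieBracket (c • b) where
  antisymm := by rw [map_smul, hb.antisymm, smul_neg]
  jacobi := by simp only [map_smul, LinearMap.smul_apply, ← smul_add, ← hb.jacobi]

theorem IsPoisson.map {e : P.obj 0} {m b : P.obj 2} (h : P.IsPoisson e m b) (f : Hom P Q) :
    Q.IsPoisson (f.app 0 e) (f.app 2 m) (f.app 2 b) where
  toIsLieBracket := h.toIsLieBracket.map f
  mul_unit i := by rw [← f.app_comp₂₀, h.mul_unit, f.app_one]
  bracket_unit i := by rw [← f.app_comp₂₀, h.bracket_unit, map_zero]
  mul_comm := by rw [← f.app_act, h.mul_comm]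
  mul_assoc := h.mul_assoc.map f
  leibniz := by simp only [← f.app_comp₂₂, ← f.app_act, ← map_add, ← h.leibniz]

theorem IsPoisson.smul {e : P.obj 0} {m b : P.obj 2} (h : P.IsPoisson e m b) (c : k) (x : kˣ) :
    P.IsPoisson (((x⁻¹ : kˣ) : k) • e) ((x : k) • m) (c • b) where
  toIsLieBracket := h.toIsLieBracket.smul c
  mul_unit i := by
    rw [map_smul, map_smul, LinearMap.smul_apply, h.mul_unit, smul_smul, Units.inv_mul, one_smul]
  bracket_unit i := by
    rw [map_smul, map_smul, LinearMap.smul_apply, h.bracket_unit, smul_zero, smul_zero]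
  mul_comm := by rw [map_smul, h.mul_comm]
  mul_assoc := by
    simp only [IsAssociative, map_smul, LinearMap.smul_apply, show _ = _ from h.mul_assoc]
  leibniz := by
    simp only [map_smul, LinearMap.smul_apply, h.leibniz, smul_add, smul_comm c (x : k)]

theorem IsPoisson.coeff_eq {e : P.obj 0} {m b : P.obj 2} (h : P.IsPoisson e m b)
    (hone : Function.Injective fun c : k => c • P.one) (hmb : LinearIndependent k ![m, b])
    {a x y z t : k} (h' : P.IsPoisson (a • e) (x • m + y • b) (z • m + t • b)) :
    a * x = 1 ∧ 2 * y = 0 ∧ z = 0 := by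
  have plug_unit (c d : k) : P.comp₂₀ 0 (c • m + d • b) (a • e) = (a * c) • P.one := by
    simp only [map_add, map_smul, LinearMap.add_apply, LinearMap.smul_apply, h.mul_unit,
      h.bracket_unit, smul_zero, add_zero, smul_smul]
  have hax : a * x = 1 := hone (by simpa only [plug_unit, one_smul] using h'.mul_unit 0)
  have haz : a * z = 0 := hone (by simpa only [plug_unit, zero_smul] using h'.bracket_unit 0)
  have hy : -y = y := by
    have hswap := h'.mul_comm
    rw [map_add, map_smul, map_smul, h.mul_comm, h.antisymm, smul_neg, ← neg_smul] at hswap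
    exact (hmb.eq_of_pair hswap).2
  exact ⟨hax, by linear_combination -hy, by linear_combination x * haz - z * hax⟩

theorem perm_fin_two (σ : Equiv.Perm (Fin 2)) : σ = 1 ∨ σ = Equiv.swap 0 1 := by
  revert σ
  decide

/-! ## Scalings and inner automorphisms -/

theorem scale_app (c : kˣ) (n : ℕ) (θ : P.obj n) :
    (P.scale c).1.app n θ = ((c ^ ((n : ℤ) - 1) : kˣ) : k) • θ := rfl

theorem scale_app_zero (c : kˣ) (θ : P.obj 0) :
    (P.scale c).1.app 0 θ = ((c⁻¹ : kˣ) : k) • θ := by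
  rw [scale_app, Nat.cast_zero, zero_sub, zpow_neg_one]

theorem scale_app_two (c : kˣ) (θ : P.obj 2) : (P.scale c).1.app 2 θ = (c : k) • θ := by
  rw [scale_app, show ((2 : ℕ) : ℤ) - 1 = 1 by norm_num, zpow_one]

theorem scale_mul_comm (c : kˣ) (Φ : P.AutGroup) : P.scale c * Φ = Φ * P.scale c :=
  Units.ext <| EndHom.ext_app fun n θ => by
    simp only [Units.val_mul, EndHom.mul_app, scale_app, map_smul]

theorem scale_injective {x : P.obj 2} (hx : Function.Injective fun c : k => c • x) :
    Function.Injective P.scale := fun c d h =>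
  Units.ext <| hx <| by
    simpa only [scale_app_two] using congrArg (fun Φ : P.AutGroup => Φ.1.app 2 x) h

theorem compAux_smul_one (a : k) {n : ℕ} (t : ℕ) (ht : t ≤ n)
    (h : n + t = n + ∑ _i : Fin t, 1) (θ : P.obj n) :
    P.compAux t (fun _ => 1) (fun _ => a • P.one) ht h θ = a ^ t • θ := by
  induction t generalizing θ with
  | zero =>
    rw [pow_zero, one_smul]
    rfl
  | succ t ih =>
    rw [P.compAux_succ (N' := n) _ _ ht h rfl (by omega) (by simp), map_smul, P.comp_one, ih,
      smul_smul, pow_succ]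

theorem plugAll_smul_one (a : k) (n : ℕ) (θ : P.obj n) :
    P.plugAll (a • P.one) n θ = a ^ n • θ :=
  compAux_smul_one a n _ _ θ

theorem comp_smul_one_smul_one (a b : k) :
    P.comp (m := 1) (n := 1) (r := 1) rfl 0 (a • P.one) (b • P.one) = (a * b) • P.one := by
  rw [map_smul, map_smul, LinearMap.smul_apply, P.one_comp, smul_smul, mul_comm]

theorem isInnerBy_scale (c : kˣ) :
    P.IsInnerBy (P.scale c).1 ((c : k) • P.one) (((c⁻¹ : kˣ) : k) • P.one) := by
  refine ⟨?_, ?_, fun n θ => ?_⟩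
  · rw [comp_smul_one_smul_one, Units.mul_inv, one_smul]
  · rw [comp_smul_one_smul_one, Units.inv_mul, one_smul]
  · rw [scale_app, plugAll_smul_one, map_smul, LinearMap.smul_apply, P.one_comp, smul_smul,
      zpow_sub_one, zpow_natCast, Units.val_mul, Units.val_pow_eq_pow_val]

theorem range_scale_eq_IAut (h : Function.Bijective fun c : k => c • P.one) :
    P.scale.range = P.IAut := by
  refine le_antisymm ?_ ?_
  · rintro _ ⟨c, rfl⟩
    exact ⟨_, _, isInnerBy_scale c⟩
  · rintro Φ ⟨x, y, hxy, -, hΦ⟩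
    obtain ⟨a, rfl⟩ := h.2 x
    obtain ⟨b, rfl⟩ := h.2 y
    have hab : a * b = 1 := h.1 <| by
      simpa only [one_smul, comp_smul_one_smul_one] using hxy
    refine ⟨Units.mkOfMulEqOne a b hab, Units.ext <| EndHom.ext_app fun n θ => ?_⟩
    rw [hΦ n θ, (isInnerBy_scale _).2.2 n θ]
    rfl

theorem exists_autGroup_mulEquiv {e : P.EndHom ≃* k × kˣ}
    (he : ∀ c : kˣ, e (P.scale c).1 = ((c : k), c)) :
    ∃ e' : P.AutGroup ≃* kˣ × kˣ, ∀ c : kˣ, e' (P.scale c) = (c, c) := by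
  refine ⟨((Units.mapEquiv e).trans MulEquiv.prodUnits).trans
    (MulEquiv.prodCongr (MulEquiv.refl _) toUnits.symm), fun c => Prod.ext ?_ ?_⟩
  · exact Units.ext (congrArg Prod.fst (he c))
  · exact Units.ext (congrArg (fun p : k × kˣ => (p.2 : k)) (he c))

/-! ## Truncations -/

/-- The projection onto a quotient operad. -/
def quotMk (P : SymOperad.{u, v} k) (I : P.OpIdeal) : Hom P (P.quot I) where
  app n := (I.sub n).mkQ
  app_one := rfl
  app_act _ _ := rfl
  app_comp _ _ _ _ := rfl

/-- The endomorphism of a quotient operad induced by an endomorphism that preserves the ideal. -/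
def quotEnd (I : P.OpIdeal) (Φ : P.EndHom) (h : ∀ n, I.sub n ≤ (I.sub n).comap (Φ.app n)) :
    (P.quot I).EndHom where
  app n := (I.sub n).mapQ (I.sub n) (Φ.app n) (h n)
  app_one := congrArg Submodule.Quotient.mk Φ.app_one
  app_act σ θ := by
    obtain ⟨θ, rfl⟩ := Submodule.Quotient.mk_surjective _ θ
    exact congrArg Submodule.Quotient.mk (Φ.app_act σ θ)
  app_comp h i μ ν := by
    obtain ⟨μ, rfl⟩ := Submodule.Quotient.mk_surjective _ μ
    obtain ⟨ν, rfl⟩ := Submodule.Quotient.mk_surjective _ ν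
    exact congrArg Submodule.Quotient.mk (Φ.app_comp h i μ ν)

theorem EndHom.truncSub_le_comap {u : P.obj 0} (Φ : P.EndHom) {c : kˣ}
    (hc : Φ.app 0 u = (c : k) • u) (K n : ℕ) :
    P.truncSub u K n ≤ (P.truncSub u K n).comap (Φ.app n) := by
  intro θ hθ
  rw [Submodule.mem_comap]
  rcases Nat.eq_zero_or_pos K with rfl | hK
  · rw [truncSub_zero]
    trivial
  induction n with
  | zero =>
    rw [P.mem_truncSub_of_lt u hK] at hθ ⊢
    rw [hθ, map_zero]
  | succ n ih =>
    rcases Nat.lt_or_ge (n + 1) K with hn | hn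
    · rw [P.mem_truncSub_of_lt u hn] at hθ ⊢
      rw [hθ, map_zero]
    · rw [P.mem_truncSub_succ u hn] at hθ ⊢
      intro i
      have h := ih (hθ i)
      rw [Φ.app_comp, hc, map_smul] at h
      exact (Submodule.smul_mem_iff_of_isUnit _ c.isUnit).mp h

/-- A surjective morphism that is injective below arity `N` and along which every endomorphism
rescaling the constant `u` by a unit descends. The truncations of an operad and the operad itself
are treated uniformly through this notion. -/
structure Hom.IsTruncation (π : Hom P Q) (u : P.obj 0) (N : ℕ) : Prop where
  surjective : ∀ n, Function.Surjective (π.app n)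
  injective : ∀ n < N, Function.Injective (π.app n)
  exists_endHom : ∀ (Φ : P.EndHom) (c : kˣ), Φ.app 0 u = (c : k) • u →
    ∃ Ψ : Q.EndHom, ∀ n θ, Ψ.app n (π.app n θ) = π.app n (Φ.app n θ)

theorem isTruncation_id (u : P.obj 0) (N : ℕ) : (Hom.id P).IsTruncation u N where
  surjective _ := Function.surjective_id
  injective _ _ := Function.injective_id
  exists_endHom Φ _ _ := ⟨Φ, fun _ _ => rfl⟩

theorem isTruncation_quotMk {u : P.obj 0} (hu : ∀ x : P.obj 0, ∃ c : k, x = c • u) {N K : ℕ}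
    (hNK : N ≤ K) : (P.quotMk (P.truncIdeal u hu K)).IsTruncation u N where
  surjective _ := Submodule.mkQ_surjective _
  injective n hn := by
    rw [← LinearMap.ker_eq_bot]
    refine (Submodule.ker_mkQ _).trans (eq_bot_iff.mpr fun θ hθ => ?_)
    exact (P.mem_truncSub_of_lt u (hn.trans_le hNK) θ).mp hθ
  exists_endHom Φ _ hc := ⟨quotEnd _ Φ (Φ.truncSub_le_comap hc K), fun _ _ => rfl⟩

namespace Hom.IsTruncation

variable {π : Hom P Q} {u : P.obj 0} {N : ℕ}

theorem bijective_smul_one (hπ : π.IsTruncation u N) (hN : 1 < N)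
    (h : Function.Bijective fun c : k => c • P.one) :
    Function.Bijective fun c : k => c • Q.one := by
  convert Function.Bijective.comp ⟨hπ.injective 1 hN, hπ.surjective 1⟩ h using 2
  rw [Function.comp_apply, map_smul, π.app_one]

theorem linearIndependent_pair (hπ : π.IsTruncation u N) (hN : 2 < N) {x y : P.obj 2}
    (h : LinearIndependent k ![x, y]) : LinearIndependent k ![π.app 2 x, π.app 2 y] := by
  refine LinearIndependent.pair_iff.mpr fun s t hst => LinearIndependent.pair_iff.mp h s t ?_
  apply hπ.injective 2 hN
  rw [map_add, map_smul, map_smul, hst, map_zero]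

theorem scale_injective (hπ : π.IsTruncation u N) (hN : 2 < N) {x : P.obj 2}
    (hx : Function.Injective fun c : k => c • x) : Function.Injective Q.scale := by
  refine SymOperad.scale_injective (x := π.app 2 x) ?_
  simpa only [← map_smul, Function.comp_def] using (hπ.injective 2 hN).comp hx

theorem exists_eq_smul (hπ : π.IsTruncation u N) (hu : ∀ x : P.obj 0, ∃ c : k, x = c • u)
    (x : Q.obj 0) : ∃ c : k, x = c • π.app 0 u := by
  obtain ⟨x, rfl⟩ := hπ.surjective 0 x
  obtain ⟨c, rfl⟩ := hu x
  exact ⟨c, map_smul _ _ _⟩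

end Hom.IsTruncation

/-! ## Operads generated by binary operations -/

/-- Membership in the suboperad generated by a set `S` of binary operations. -/
inductive BinGen (P : SymOperad.{u, v} k) (S : Set (P.obj 2)) : ∀ n, P.obj n → Prop
  | one : BinGen P S 1 P.one
  | gen (x : P.obj 2) : x ∈ S → BinGen P S 2 x
  | zero (n : ℕ) : BinGen P S n 0
  | add {n : ℕ} (x y : P.obj n) : BinGen P S n x → BinGen P S n y → BinGen P S n (x + y)
  | smul {n : ℕ} (c : k) (x : P.obj n) : BinGen P S n x → BinGen P S n (c • x)
  | act {n : ℕ} (σ : Equiv.Perm (Fin n)) (x : P.obj n) : BinGen P S n x → BinGen P S n (P.act σ x)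
  | comp {m n r : ℕ} (h : r + 1 = m + n) (i : Fin m) (x : P.obj m) (y : P.obj n) :
      BinGen P S m x → BinGen P S n y → BinGen P S r (P.comp h i x y)

/-- The submodules `0`, `k · 1`, `M` of the components of arity `0`, `1`, `2`, and everything in
higher arities; these bound the suboperad generated by `M`. -/
def lowArity (M : Submodule k (P.obj 2)) : ∀ n, Submodule k (P.obj n)
  | 0 => ⊥
  | 1 => Submodule.span k {P.one}
  | 2 => M
  | _ + 3 => ⊤

variable {M : Submodule k (P.obj 2)} {S : Set (P.obj 2)}

theorem act_mem_lowArity (hM : ∀ x ∈ M, P.act (Equiv.swap 0 1) x ∈ M) {n : ℕ}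
    (σ : Equiv.Perm (Fin n)) {x : P.obj n} (hx : x ∈ lowArity M n) :
    P.act σ x ∈ lowArity M n := by
  match n, σ, x, hx with
  | 0, σ, x, hx | 1, σ, x, hx =>
    rwa [Subsingleton.elim σ 1, P.act_one]
  | 2, σ, x, hx =>
    rcases perm_fin_two σ with rfl | rfl
    · rwa [P.act_one]
    · exact hM x hx
  | _ + 3, _, _, _ => trivial

theorem comp_mem_lowArity {m n r : ℕ} (h : r + 1 = m + n) (i : Fin m) {x : P.obj m} {y : P.obj n}
    (hx : x ∈ lowArity M m) (hy : y ∈ lowArity M n) : P.comp h i x y ∈ lowArity M r := by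
  match n, y, hy with
  | 0, y, hy =>
    rw [(Submodule.mem_bot k).mp hy, map_zero]
    exact zero_mem _
  | 1, y, hy =>
    obtain ⟨c, rfl⟩ := Submodule.mem_span_singleton.mp hy
    obtain rfl : r = m := by omega
    rw [map_smul, P.comp_one]
    exact Submodule.smul_mem _ c hx
  | n + 2, y, hy =>
    match m, i, x, hx with
    | 1, i, x, hx =>
      obtain ⟨c, rfl⟩ := Submodule.mem_span_singleton.mp hx
      obtain rfl : r = n + 2 := by omega
      obtain rfl : i = 0 := Subsingleton.elim _ _
      rw [map_smul, LinearMap.smul_apply, P.one_comp]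
      exact Submodule.smul_mem _ c hy
    | m + 2, _, _, _ =>
      obtain rfl : r = m + n + 3 := by omega
      trivial

theorem BinGen.mem_lowArity (hS : S ⊆ M) (hM : ∀ x ∈ M, P.act (Equiv.swap 0 1) x ∈ M) {n : ℕ}
    {x : P.obj n} (hx : P.BinGen S n x) : x ∈ lowArity M n := by
  induction hx with
  | one => exact Submodule.mem_span_singleton_self _
  | gen x hx => exact hS hx
  | zero n => exact zero_mem _
  | add x y _ _ hx hy => exact add_mem hx hy
  | smul c x _ hx => exact Submodule.smul_mem _ c hx
  | act σ x _ hx => exact act_mem_lowArity hM σ hx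
  | comp h i x y _ _ hx hy => exact comp_mem_lowArity h i hx hy

theorem BinGen.exists_eq_smul_one {x : P.obj 1} (hx : P.BinGen S 1 x) : ∃ c : k, c • P.one = x :=
  Submodule.mem_span_singleton.mp
    (hx.mem_lowArity (M := ⊤) (fun _ _ => trivial) fun _ _ => trivial)

theorem BinGen.comp_unit {u : P.obj 0} (hu : ∀ x ∈ S, ∀ i, ∃ c : k, P.comp₂₀ i x u = c • P.one)
    {N : ℕ} {x : P.obj N} (hx : P.BinGen S N x) {r : ℕ} (h : r + 1 = N + 0) (hr : 0 < r)
    (i : Fin N) : P.BinGen S r (P.comp h i x u) := by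
  induction hx generalizing r with
  | one => omega
  | gen x hx =>
    obtain rfl : r = 1 := by omega
    obtain ⟨c, hc⟩ := hu x hx i
    rw [hc]
    exact .smul _ _ .one
  | zero n =>
    rw [map_zero, LinearMap.zero_apply]
    exact .zero _
  | add x y _ _ hx hy =>
    rw [map_add, LinearMap.add_apply]
    exact .add _ _ (hx h hr i) (hy h hr i)
  | smul c x _ hx =>
    rw [map_smul, LinearMap.smul_apply]
    exact .smul _ _ (hx h hr i)
  | act σ x _ hx =>
    rw [P.act_comp]
    exact .act _ _ (hx h hr _)
  | @comp m n N h' j x y hx' hy' hx hy =>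
    obtain rfl : N = r + 1 := by omega
    -- the unit is plugged either into an input of `y` or into an input of `x`
    refine P.comp_comp_unit u h' j i x y (C := P.BinGen S r) ?_ ?_
    · rintro n' rfl hr' p
      rcases Nat.eq_zero_or_pos n' with rfl | hn'
      · obtain ⟨c, rfl⟩ := hy'.exists_eq_smul_one
        obtain rfl : p = 0 := Subsingleton.elim (α := Fin 1) _ _
        rw [map_smul, LinearMap.smul_apply, P.one_comp, map_smul]
        exact .smul _ _ (hx hr' hr j)
      · exact .comp _ _ _ _ hx' (hy _ hn' p)
    · rintro m' rfl hr' q j'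
      exact .comp _ _ _ _ (hx _ (Fin.pos j') q) hy'

end SymOperad

/-! ## The universal property of presented operads -/

namespace OpTerm

open SymOperad

variable {k : Type u} [CommRing k] {X : ℕ → Type}

/-- Evaluation of expressions in an operad. -/
def eval (Q : SymOperad.{u, w} k) (g : ∀ n, X n → Q.obj n) : ∀ {n : ℕ}, OpTerm k X n → Q.obj n
  | _, gen x => g _ x
  | _, one => Q.one
  | _, zero _ => 0
  | _, add a b => eval Q g a + eval Q g b
  | _, smul c a => c • eval Q g a
  | _, act σ a => Q.act σ (eval Q g a)
  | _, comp h i a b => Q.comp h i (eval Q g a) (eval Q g b)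

variable {R : ∀ n, OpTerm k X n → OpTerm k X n → Prop}

theorem eval_eq_of_rel (Q : SymOperad.{u, w} k) (g : ∀ n, X n → Q.obj n)
    (hR : ∀ n a b, R n a b → eval Q g a = eval Q g b) {n : ℕ} {a b : OpTerm k X n}
    (h : Rel R a b) : eval Q g a = eval Q g b := by
  induction h with
  | of h => exact hR _ _ _ h
  | refl => rfl
  | symm _ ih => exact ih.symm
  | trans _ _ ih ih' => exact ih.trans ih'
  | add_congr _ _ ih ih' => simp only [eval, ih, ih']
  | smul_congr _ _ ih => simp only [eval, ih]
  | act_congr _ _ ih => simp only [eval, ih]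
  | comp_congr _ _ _ _ ih ih' => simp only [eval, ih, ih']
  | add_assoc => exact _root_.add_assoc _ _ _
  | add_comm => exact _root_.add_comm _ _
  | zero_add => exact _root_.zero_add _
  | zero_smul => exact _root_.zero_smul _ _
  | one_smul => exact _root_.one_smul _ _
  | mul_smul => exact SemigroupAction.mul_smul _ _ _
  | add_smul => exact _root_.add_smul _ _ _
  | smul_add => exact _root_.smul_add _ _ _
  | act_add => exact map_add _ _ _
  | act_smul => exact map_smul _ _ _
  | comp_add => exact map_add _ _ _
  | comp_smul => exact map_smul _ _ _
  | add_comp => exact LinearMap.map_add₂ _ _ _ _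
  | smul_comp => exact LinearMap.map_smul₂ _ _ _ _
  | act_one => exact Q.act_one _
  | act_mul => exact Q.act_mul _ _ _
  | comp_one => exact Q.comp_one _ _ _
  | one_comp => exact Q.one_comp _ _
  | assoc h₁ h₂ h₃ h₄ i j q hq => exact Q.assoc h₁ h₂ h₃ h₄ i j q hq _ _ _
  | comm h₁ h₂ h₃ h₄ i c hic q hq q' hq' => exact Q.comm h₁ h₂ h₃ h₄ i c hic q hq q' hq' _ _ _
  | comp_act => exact Q.comp_act _ _ _ _ _
  | act_comp => exact Q.act_comp _ _ _ _ _

/-- The morphism out of a presented operad given by images of the generators that satisfy the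
relations. -/
def lift (Q : SymOperad.{u, w} k) (g : ∀ n, X n → Q.obj n)
    (hR : ∀ n a b, R n a b → eval Q g a = eval Q g b) : Hom (presented R) Q where
  app n :=
    { toFun := Quotient.lift (eval Q g) (fun _ _ h => eval_eq_of_rel Q g hR h)
      map_add' := by
        rintro ⟨a⟩ ⟨b⟩
        rfl
      map_smul' := by
        rintro c ⟨a⟩
        rfl }
  app_one := rfl
  app_act := by
    rintro n σ ⟨a⟩
    rfl
  app_comp := by
    rintro m n r h i ⟨a⟩ ⟨b⟩
    rfl

/-- A generator, as an element of the presented operad. -/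
def genCls (R : ∀ n, OpTerm k X n → OpTerm k X n → Prop) {n : ℕ} (x : X n) : (presented R).obj n :=
  cls R (gen x)

theorem eval_genCls {n : ℕ} (a : OpTerm k X n) :
    eval (presented R) (fun _ x => genCls R x) a = cls R a := by
  induction a with
  | gen => rfl
  | one => rfl
  | zero => rfl
  | add a b ha hb => simp only [eval, ha, hb]; rfl
  | smul c a ha => simp only [eval, ha]; rfl
  | act σ a ha => simp only [eval, ha]; rfl
  | comp h i a b ha hb => simp only [eval, ha, hb]; rfl

theorem eval_genCls_eq {n : ℕ} {a b : OpTerm k X n} (h : R n a b) :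
    eval (presented R) (fun _ x => genCls R x) a =
      eval (presented R) (fun _ x => genCls R x) b := by
  rw [eval_genCls, eval_genCls]
  exact cls_eq R (.of h)

theorem presented_induction {C : ∀ n, (presented R).obj n → Prop}
    (gen : ∀ {n : ℕ} (x : X n), C n (genCls R x)) (one : C 1 (presented R).one)
    (zero : ∀ n, C n 0)
    (add : ∀ {n : ℕ} (x y : (presented R).obj n), C n x → C n y → C n (x + y))
    (smul : ∀ {n : ℕ} (c : k) (x : (presented R).obj n), C n x → C n (c • x))
    (act : ∀ {n : ℕ} (σ : Equiv.Perm (Fin n)) (x : (presented R).obj n), C n x →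
      C n ((presented R).act σ x))
    (comp : ∀ {m n r : ℕ} (h : r + 1 = m + n) (i : Fin m) (x : (presented R).obj m)
      (y : (presented R).obj n), C m x → C n y → C r ((presented R).comp h i x y))
    {n : ℕ} (x : (presented R).obj n) : C n x := by
  obtain ⟨a, rfl⟩ := cls_surj R x
  induction a with
  | gen x => exact gen x
  | one => exact one
  | zero n => exact zero n
  | add a b ha hb => exact add _ _ ha hb
  | smul c a ha => exact smul c _ ha
  | act σ a ha => exact act σ _ ha
  | comp h i a b ha hb => exact comp h i _ _ ha hb

theorem hom_ext {Q : SymOperad.{u, w} k} {f g : Hom (presented R) Q}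
    (h : ∀ n (x : X n), f.app n (genCls R x) = g.app n (genCls R x)) : f = g := by
  refine Hom.ext_app fun n x => ?_
  induction x using presented_induction with
  | gen x => exact h _ x
  | one => rw [f.app_one, g.app_one]
  | zero n => rw [map_zero, map_zero]
  | add x y hx hy => rw [map_add, map_add, hx, hy]
  | smul c x hx => rw [map_smul, map_smul, hx]
  | act σ x hx => rw [f.app_act, g.app_act, hx]
  | comp h i x y hx hy => rw [f.app_comp, g.app_comp, hx, hy]

end OpTerm

/-! ## The operad of symbols -/

namespace SymbolOperad

/-- The input of `μ` that an input of `μ ∘ᵢ ν` belongs to. -/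
def col {m n r : ℕ} (h : r + 1 = m + n) (i : Fin m) (p : Fin r) : Fin m :=
  if _ : p.1 < i.1 then ⟨p.1, by have := i.2; omega⟩
  else if _ : p.1 < i.1 + n then i else ⟨p.1 + 1 - n, by have := p.2; omega⟩

/-- The inclusion of the inputs of `ν` into those of `μ ∘ᵢ ν`. -/
def emb {m n r : ℕ} (h : r + 1 = m + n) (i : Fin m) (t : Fin n) : Fin r :=
  ⟨i.1 + t.1, by have := i.2; have := t.2; omega⟩

theorem col_val {m n r : ℕ} (h : r + 1 = m + n) (i : Fin m) (p : Fin r) :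
    (col h i p).1 = if p.1 < i.1 then p.1 else if p.1 < i.1 + n then i.1 else p.1 + 1 - n := by
  unfold col
  split_ifs <;> rfl

theorem emb_val {m n r : ℕ} (h : r + 1 = m + n) (i : Fin m) (t : Fin n) :
    (emb h i t).1 = i.1 + t.1 := rfl

theorem emb_injective {m n r : ℕ} (h : r + 1 = m + n) (i : Fin m) :
    Function.Injective (emb h i) := fun s t hst => by
  simpa only [Fin.ext_iff, emb_val, Nat.add_left_cancel_iff] using hst

theorem col_permComp {m n r : ℕ} (h : r + 1 = m + n) (φ : Equiv.Perm (Fin m)) (i : Fin m)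
    (σ : Equiv.Perm (Fin n)) (p : Fin r) :
    col h (φ i) (permComp h φ i σ p) = φ (col h i p) := by
  apply Fin.ext
  rcases ins_cases h i p with ⟨j, hj, hp⟩ | ⟨t, hp⟩
  · have hj' : j.1 ≠ i.1 := fun e => hj (Fin.ext e)
    have hφ : (φ j).1 ≠ (φ i).1 := fun e => hj (φ.injective (Fin.ext e))
    have hc : col h i p = j := by
      apply Fin.ext
      rw [col_val]
      split_ifs at hp ⊢ <;> omega
    rw [col_val, permComp_inl h φ i σ p j hj hp, hc]
    split_ifs <;> omega
  · have hc : col h i p = i := by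
      apply Fin.ext
      rw [col_val]
      split_ifs <;> omega
    rw [col_val, permComp_inr h φ i σ p t hp, hc]
    have := (σ t).2
    split_ifs <;> omega

theorem permComp_emb {m n r : ℕ} (h : r + 1 = m + n) (φ : Equiv.Perm (Fin m)) (i : Fin m)
    (σ : Equiv.Perm (Fin n)) (t : Fin n) :
    permComp h φ i σ (emb h i t) = emb h (φ i) (σ t) :=
  Fin.ext (permComp_inr h φ i σ _ t rfl)

theorem permComp_symm_emb {m n r : ℕ} (h : r + 1 = m + n) (φ : Equiv.Perm (Fin m)) (i : Fin m)
    (σ : Equiv.Perm (Fin n)) :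
    (permComp h φ i σ).symm ∘ emb h (φ i) = emb h i ∘ σ.symm := by
  funext t
  rw [Function.comp_apply, Equiv.symm_apply_eq, Function.comp_apply, permComp_emb,
    Equiv.apply_symm_apply]

section Nested

variable {l m n a b s : ℕ} (h₁ : a + 1 = l + m) (h₂ : s + 1 = a + n) (h₃ : b + 1 = m + n)
  (h₄ : s + 1 = l + b) (i : Fin l) (j : Fin m) (q : Fin a)

include h₃ in
theorem col_comp_col (hq : q.1 = i.1 + j.1) : col h₁ i ∘ col h₂ q = col h₄ i := by
  funext p
  apply Fin.ext
  simp only [Function.comp_apply, col_val]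
  split_ifs <;> omega

theorem emb_comp_emb (hq : q.1 = i.1 + j.1) : emb h₄ i ∘ emb h₃ j = emb h₂ q := by
  funext t
  apply Fin.ext
  simp only [Function.comp_apply, emb_val]
  omega

theorem col_eq_emb_iff (hq : q.1 = i.1 + j.1) (p : Fin s) (y : Fin m) :
    col h₂ q p = emb h₁ i y ↔ ∃ t, emb h₄ i t = p ∧ col h₃ j t = y := by
  have hy := y.2
  constructor
  · intro e
    have e := congrArg Fin.val e
    rw [col_val, emb_val] at e
    have hip : i.1 ≤ p.1 := by split_ifs at e <;> omega
    have hpb : p.1 - i.1 < b := by split_ifs at e <;> omega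
    refine ⟨⟨p.1 - i.1, hpb⟩, Fin.ext (Nat.add_sub_cancel' hip), Fin.ext ?_⟩
    rw [col_val]
    dsimp only
    split_ifs at e ⊢ <;> omega
  · rintro ⟨t, rfl, rfl⟩
    apply Fin.ext
    rw [col_val, emb_val, emb_val, col_val]
    split_ifs <;> omega

end Nested

section Disjoint

variable {l m n a b s : ℕ} (h₁ : a + 1 = l + m) (h₂ : s + 1 = a + n) (h₃ : b + 1 = l + n)
  (h₄ : s + 1 = b + m) {i c : Fin l} (hic : i.1 < c.1) {q : Fin a} (hq : q.1 + 1 = c.1 + m)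
  {q' : Fin b} (hq' : q'.1 = i.1)

include hic hq hq'

theorem col_comp_col_comm : col h₁ i ∘ col h₂ q = col h₃ c ∘ col h₄ q' := by
  funext p
  apply Fin.ext
  simp only [Function.comp_apply, col_val]
  split_ifs <;> omega

include h₃ in
theorem col_eq_emb_left_iff (p : Fin s) (y : Fin m) :
    col h₂ q p = emb h₁ i y ↔ p = emb h₄ q' y := by
  simp only [Fin.ext_iff, col_val, emb_val]
  split_ifs <;> omega

include h₁ in
theorem col_eq_emb_right_iff (p : Fin s) (y : Fin n) :
    col h₄ q' p = emb h₃ c y ↔ p = emb h₂ q y := by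
  simp only [Fin.ext_iff, col_val, emb_val]
  split_ifs <;> omega

end Disjoint

section Push

variable {V : Type v} [AddCommMonoid V]

/-- Summation along the fibres of a map. -/
def push {m r : ℕ} (c : Fin r → Fin m) (v : Fin r → V) (j : Fin m) : V :=
  ∑ p with c p = j, v p

theorem push_push {l m r : ℕ} (c : Fin m → Fin l) (d : Fin r → Fin m) (v : Fin r → V) :
    push c (push d v) = push (c ∘ d) v := by
  funext j
  refine (Finset.sum_fiberwise_eq_sum_filter _ _ d v).trans ?_
  simp only [Finset.mem_filter_univ]
  rfl

theorem push_apply_of_unique {m r : ℕ} {c : Fin r → Fin m} {j : Fin m} {q : Fin r}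
    (h : ∀ p, c p = j ↔ p = q) (v : Fin r → V) : push c v j = v q := by
  simp only [push, h, Finset.filter_eq', Finset.mem_univ, if_true, Finset.sum_singleton]

theorem push_equiv {m r : ℕ} (c : Fin r → Fin m) (σ : Equiv.Perm (Fin r)) (v : Fin r → V) :
    push c (v ∘ σ.symm) = push (c ∘ σ) v :=
  funext fun j => Finset.sum_equiv σ.symm (by simp) (by simp)

theorem equiv_push {m r : ℕ} (c : Fin r → Fin m) (φ : Equiv.Perm (Fin m)) (v : Fin r → V) :
    push c v ∘ φ.symm = push (φ ∘ c) v := by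
  funext j
  simp only [push, Function.comp_apply, Equiv.eq_symm_apply]

theorem push_apply_of_pullback {m r n b : ℕ} {c : Fin r → Fin m} {c' : Fin b → Fin n}
    {e : Fin b → Fin r} (he : Function.Injective e) {j : Fin m} {y : Fin n}
    (h : ∀ p, c p = j ↔ ∃ t, e t = p ∧ c' t = y) (v : Fin r → V) :
    push c v j = push c' (v ∘ e) y := by
  symm
  refine Finset.sum_bij (fun t _ => e t) ?_ (fun _ _ _ _ ht => he ht) ?_ fun _ _ => rfl
  · intro t ht
    rw [Finset.mem_filter_univ] at ht ⊢
    exact (h _).mpr ⟨t, rfl, ht⟩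
  · intro p hp
    rw [Finset.mem_filter_univ] at hp
    obtain ⟨t, ht, hy⟩ := (h p).mp hp
    exact ⟨t, (Finset.mem_filter_univ t).mpr hy, ht⟩

end Push

variable (k : Type u) [CommRing k]

section Comp

variable (V : Type v) [AddCommMonoid V]

/-- Partial composition of symbols. The momentum of an input of `μ` in `μ ∘ᵢ ν` is the sum of the
momenta of the inputs over it. -/
def comp {m n r : ℕ} (h : r + 1 = m + n) (i : Fin m) :
    ((Fin m → V) → k) →ₗ[k] ((Fin n → V) → k) →ₗ[k] ((Fin r → V) → k) :=
  LinearMap.mk₂ k (fun f g v => f (push (col h i) v) * g (v ∘ emb h i))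
    (fun _ _ _ => funext fun _ => add_mul _ _ _)
    (fun _ _ _ => funext fun _ => mul_assoc _ _ _)
    (fun _ _ _ => funext fun _ => mul_add _ _ _)
    (fun _ _ _ => funext fun _ => mul_left_comm _ _ _)

variable {k V}

theorem comp_apply {m n r : ℕ} (h : r + 1 = m + n) (i : Fin m) (f : (Fin m → V) → k)
    (g : (Fin n → V) → k) (v : Fin r → V) :
    comp k V h i f g v = f (push (col h i) v) * g (v ∘ emb h i) := rfl

theorem comp_comp_of_add {l m n a b s : ℕ} (h₁ : a + 1 = l + m) (h₂ : s + 1 = a + n)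
    (h₃ : b + 1 = m + n) (h₄ : s + 1 = l + b) (i : Fin l) (j : Fin m) (q : Fin a)
    (hq : q.1 = i.1 + j.1) (α : (Fin l → V) → k) (β : (Fin m → V) → k) (γ : (Fin n → V) → k) :
    comp k V h₂ q (comp k V h₁ i α β) γ = comp k V h₄ i α (comp k V h₃ j β γ) := by
  funext v
  have hβ : push (col h₂ q) v ∘ emb h₁ i = push (col h₃ j) (v ∘ emb h₄ i) := funext fun y =>
    push_apply_of_pullback (emb_injective h₄ i)
      (fun p => col_eq_emb_iff h₁ h₂ h₃ h₄ i j q hq p y) v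
  rw [comp_apply, comp_apply, comp_apply, comp_apply, mul_assoc, push_push, hβ,
    col_comp_col h₁ h₂ h₃ h₄ i j q hq, Function.comp_assoc, emb_comp_emb h₂ h₃ h₄ i j q hq]

theorem comp_comp_of_lt {l m n a b s : ℕ} (h₁ : a + 1 = l + m) (h₂ : s + 1 = a + n)
    (h₃ : b + 1 = l + n) (h₄ : s + 1 = b + m) (i c : Fin l) (hic : i.1 < c.1) (q : Fin a)
    (hq : q.1 + 1 = c.1 + m) (q' : Fin b) (hq' : q'.1 = i.1) (α : (Fin l → V) → k)
    (β : (Fin m → V) → k) (γ : (Fin n → V) → k) :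
    comp k V h₂ q (comp k V h₁ i α β) γ = comp k V h₄ q' (comp k V h₃ c α γ) β := by
  funext v
  have hβ : push (col h₂ q) v ∘ emb h₁ i = v ∘ emb h₄ q' := funext fun y =>
    push_apply_of_unique (col_eq_emb_left_iff h₁ h₂ h₃ h₄ hic hq hq' · y) v
  have hγ : push (col h₄ q') v ∘ emb h₃ c = v ∘ emb h₂ q := funext fun y =>
    push_apply_of_unique (col_eq_emb_right_iff h₁ h₂ h₃ h₄ hic hq hq' · y) v
  rw [comp_apply, comp_apply, comp_apply, comp_apply, push_push, push_push, hβ, hγ,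
    col_comp_col_comm h₁ h₂ h₃ h₄ hic hq hq', mul_right_comm]

theorem comp_reindex {m n r : ℕ} (h : r + 1 = m + n) (φ : Equiv.Perm (Fin m)) (i : Fin m)
    (σ : Equiv.Perm (Fin n)) (f : (Fin m → V) → k) (g : (Fin n → V) → k) (v : Fin r → V) :
    comp k V h i (fun v => f (v ∘ φ.symm)) (fun v => g (v ∘ σ.symm)) v =
      comp k V h (φ i) f g (v ∘ (permComp h φ i σ).symm) := by
  have hcol : col h (φ i) ∘ permComp h φ i σ = φ ∘ col h i := funext (col_permComp h φ i σ)
  rw [comp_apply, comp_apply, push_equiv, equiv_push, hcol, Function.comp_assoc,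
    Function.comp_assoc, permComp_symm_emb]

end Comp

/-- The operad of symbols: the operations of arity `n` are the functions of `n` momenta in `V`. For
polynomials they are the symbols of polydifferential operators with constant coefficients. -/
def symbolOperad (V : Type v) [AddCommMonoid V] : SymOperad.{u, max u v} k where
  obj n := (Fin n → V) → k
  act σ := LinearMap.funLeft k k (fun v => v ∘ σ.symm)
  one := fun _ => 1
  comp h i := comp k V h i
  act_one _ := rfl
  act_mul _ _ _ := rfl
  comp_one h i θ := by
    funext v
    rw [comp_apply, mul_one]
    refine congrArg θ (funext fun j => push_apply_of_unique (fun p => ?_) v)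
    rw [Fin.ext_iff, Fin.ext_iff, col_val]
    split_ifs <;> omega
  one_comp h θ := by
    funext v
    rw [comp_apply, one_mul]
    exact congrArg θ (funext fun t => congrArg v (Fin.ext (Nat.zero_add _)))
  assoc := comp_comp_of_add
  comm := comp_comp_of_lt
  comp_act h i μ ν σ := funext (comp_reindex h 1 i σ μ ν)
  act_comp h i μ ν φ := funext (comp_reindex h φ i 1 μ ν)

theorem injective_smul_one (V : Type v) [AddCommMonoid V] :
    Function.Injective fun c : k => c • (symbolOperad k V).one := fun c d h => by
  have h0 : c * 1 = d * 1 := congrFun h 0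
  rwa [mul_one, mul_one] at h0

/-- The symbol of the Poisson bracket on the plane. -/
def bracket : (symbolOperad k (k × k)).obj 2 := fun v => (v 0).1 * (v 1).2 - (v 1).1 * (v 0).2

/-- The symbol of the pointwise product. -/
def mul : (symbolOperad k (k × k)).obj 2 := fun _ => 1

/-- The symbol of the constant function `1`. -/
def unit : (symbolOperad k (k × k)).obj 0 := fun _ => 1

section Ternary

variable {k} {V : Type v} [AddCommMonoid V] (f g : (symbolOperad k V).obj 2)

theorem comp₂₂_zero_apply (v : Fin 3 → V) :
    (symbolOperad k V).comp₂₂ 0 f g v = f ![v 0 + v 1, v 2] * g ![v 0, v 1] := by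
  refine (comp_apply (n := 2) rfl 0 f g v).trans (congrArg₂ (f · * g ·) (funext fun j => ?_)
    (funext fun j => ?_)) <;>
  fin_cases j <;> simp [push, col, emb, Finset.sum_filter, Fin.sum_univ_three]

theorem comp₂₂_one_apply (v : Fin 3 → V) :
    (symbolOperad k V).comp₂₂ 1 f g v = f ![v 0, v 1 + v 2] * g ![v 1, v 2] := by
  refine (comp_apply (n := 2) rfl 1 f g v).trans (congrArg₂ (f · * g ·) (funext fun j => ?_)
    (funext fun j => ?_)) <;>
  fin_cases j <;> simp [push, col, emb, Finset.sum_filter, Fin.sum_univ_three]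

theorem swap_act_comp₂₂_one_apply (v : Fin 3 → V) :
    (symbolOperad k V).act (Equiv.swap 0 1) ((symbolOperad k V).comp₂₂ 1 f g) v =
      f ![v 1, v 0 + v 2] * g ![v 0, v 2] :=
  comp₂₂_one_apply f g _

end Ternary

theorem isPoisson : (symbolOperad k (k × k)).IsPoisson (unit k) (mul k) (bracket k) where
  antisymm := by
    funext v
    change bracket k _ = -bracket k v
    simp only [bracket, Function.comp_apply, Equiv.symm_swap, Equiv.swap_apply_left,
      Equiv.swap_apply_right]
    ring
  jacobi := by
    funext v
    refine (comp₂₂_one_apply _ _ v).trans (Eq.trans ?_ (congrArg₂ (· + ·)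
      (comp₂₂_zero_apply (bracket k) (bracket k) v)
      (swap_act_comp₂₂_one_apply (bracket k) (bracket k) v)).symm)
    simp only [bracket, Matrix.cons_val_zero, Matrix.cons_val_one, Prod.fst_add, Prod.snd_add]
    ring
  mul_unit _ := funext fun _ => mul_one (1 : k)
  bracket_unit i := by
    funext v
    change bracket k _ * unit k _ = 0
    fin_cases i <;> simp [bracket, unit, push, col]
  mul_comm := rfl
  mul_assoc := rfl
  leibniz := by
    funext v
    refine (comp₂₂_zero_apply _ _ v).trans (Eq.trans ?_ (congrArg₂ (· + ·)
      (comp₂₂_one_apply (mul k) (bracket k) v)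
      (swap_act_comp₂₂_one_apply (mul k) (bracket k) v)).symm)
    simp only [mul, bracket, Matrix.cons_val_zero, Matrix.cons_val_one, Prod.fst_add,
      Prod.snd_add]
    ring

theorem linearIndependent_mul_bracket : LinearIndependent k ![mul k, bracket k] := by
  refine LinearIndependent.pair_iff.mpr fun c d h => ?_
  have eval (v : Fin 2 → k × k) : c * 1 + d * ((v 0).1 * (v 1).2 - (v 1).1 * (v 0).2) = 0 :=
    congrFun h v
  have hc : c = 0 := by simpa using eval 0
  have hd : c + d = 0 := by simpa using eval ![(1, 0), (0, 1)]
  exact ⟨hc, by rwa [hc, zero_add] at hd⟩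

theorem sq_eq_zero_of_isAssociative {x y : k}
    (h : (symbolOperad k (k × k)).IsAssociative (x • mul k + y • bracket k)) : y ^ 2 = 0 := by
  have hv := (comp₂₂_zero_apply _ _ _).symm.trans
    ((congrFun h ![(1, 0), (1, 0), (0, 1)]).trans (comp₂₂_one_apply _ _ _))
  have eval (p q : k × k) :
      (x • mul k + y • bracket k) ![p, q] = x * 1 + y * (p.1 * q.2 - q.1 * p.2) := rfl
  simp only [eval, Matrix.cons_val, Prod.fst_add, Prod.snd_add] at hv
  linear_combination -hv

end SymbolOperad

/-! ## The Lie operad -/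

namespace LieOperad

open SymOperad OpTerm

variable (k : Type u) [CommRing k]

/-- The Lie bracket. -/
def br : (Lie k).obj 2 := genCls (Relators k) Gen.bracket

theorem isLieBracket : (Lie k).IsLieBracket (br k) where
  antisymm := (eval_genCls_eq (R := Relators k) Relators.antisymm).trans (neg_one_smul k (br k))
  jacobi := eval_genCls_eq (R := Relators k) Relators.jacobi

variable {k} {Q : SymOperad.{u, w} k}

/-- The morphism to an operad given by a Lie bracket in it. -/
def lift {b : Q.obj 2} (hb : Q.IsLieBracket b) : Hom (Lie k) Q :=
  OpTerm.lift Q (fun _ x => match x with | Gen.bracket => b) fun _ _ _ h => by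
    cases h with
    | antisymm => exact hb.antisymm.trans (neg_one_smul k b).symm
    | jacobi => exact hb.jacobi

theorem hom_ext {f g : Hom (Lie k) Q} (h : f.app 2 (br k) = g.app 2 (br k)) : f = g :=
  OpTerm.hom_ext (R := Relators k) (by rintro n ⟨⟩; exact h)

theorem end_ext {Φ Ψ : (Lie k).EndHom} (h : Φ.app 2 (br k) = Ψ.app 2 (br k)) : Φ = Ψ :=
  EndHom.eq_of_compHom_eq (f := Hom.id _) (fun _ => Function.surjective_id) (hom_ext h)

theorem mem_lowArity {n : ℕ} (x : (Lie k).obj n) :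
    x ∈ lowArity (Submodule.span k {br k}) n := by
  induction x using presented_induction with
  | gen x =>
    cases x
    exact Submodule.mem_span_singleton_self (br k)
  | one => exact Submodule.mem_span_singleton_self (Lie k).one
  | zero n => exact zero_mem _
  | add x y hx hy => exact add_mem hx hy
  | smul c x hx => exact Submodule.smul_mem _ c hx
  | act σ x hx =>
    refine act_mem_lowArity (fun y hy => ?_) σ hx
    obtain ⟨c, rfl⟩ := Submodule.mem_span_singleton.mp hy
    rw [((isLieBracket k).smul c).antisymm]
    exact neg_mem hy
  | comp h i x y hx hy => exact comp_mem_lowArity h i hx hy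

/-- The endomorphism multiplying the bracket by `c`. -/
def brScale (c : k) : (Lie k).EndHom :=
  (lift ((isLieBracket k).smul c)).toEndHom

theorem brScale_br (c : k) : (brScale c).app 2 (br k) = c • br k := rfl

variable (k)

/-- The morphism to the operad of symbols on the plane given by the Poisson bracket. -/
def toSymbol : Hom (Lie k) (SymbolOperad.symbolOperad k (k × k)) :=
  lift (SymbolOperad.isPoisson k).toIsLieBracket

theorem bijective_smul_one : Function.Bijective fun c : k => c • (Lie k).one :=
  ⟨(toSymbol k).injective_smul_one (SymbolOperad.injective_smul_one k (k × k)),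
    fun x => Submodule.mem_span_singleton.mp (mem_lowArity x)⟩

theorem bijective_smul_br : Function.Bijective fun c : k => c • br k := by
  refine ⟨fun c d h => ?_, fun x => Submodule.mem_span_singleton.mp (mem_lowArity x)⟩
  refine (SymbolOperad.linearIndependent_mul_bracket k).smul_left_injective 1 ?_
  have map_br (a : k) : (toSymbol k).app 2 (a • br k) = a • SymbolOperad.bracket k := map_smul _ _ _
  exact (map_br c).symm.trans ((congrArg _ h).trans (map_br d))

/-- Rescaling of the bracket, as a homomorphism of monoids. -/
def brScaleHom : k →* (Lie k).EndHom where
  toFun := brScale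
  map_one' := end_ext (by rw [brScale_br, one_smul]; rfl)
  map_mul' c d := end_ext <| by
    rw [EndHom.mul_app, brScale_br, brScale_br, map_smul, brScale_br, smul_smul, mul_comm]

theorem bijective_brScaleHom : Function.Bijective (brScaleHom k) := by
  refine ⟨fun c d h => (bijective_smul_br k).1 ?_, fun Φ => ?_⟩
  · exact congrArg (fun Φ : (Lie k).EndHom => Φ.app 2 (br k)) h
  · obtain ⟨c, hc⟩ := (bijective_smul_br k).2 (Φ.app 2 (br k))
    exact ⟨c, end_ext hc⟩

/-- An endomorphism of the Lie operad corresponds to the factor by which it rescales the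
bracket. -/
noncomputable def endEquiv : (Lie k).EndHom ≃* k :=
  (MulEquiv.ofBijective (brScaleHom k) (bijective_brScaleHom k)).symm

theorem endEquiv_scale (c : kˣ) : endEquiv k ((Lie k).scale c).1 = c := by
  rw [endEquiv, MulEquiv.symm_apply_eq]
  exact end_ext (scale_app_two c (br k))

theorem range_scale_eq_top : (Lie k).scale.range = ⊤ := by
  refine MonoidHom.range_eq_top.mpr fun Φ => ⟨Units.mapEquiv (endEquiv k) Φ, Units.ext ?_⟩
  exact (endEquiv k).injective (endEquiv_scale k _)

end LieOperad

/-! ## Group extensions -/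

section Group

variable {G H N : Type*} [Group G] [Group H] [Group N]

theorem nonempty_quotient_mulEquiv {M : Subgroup G} [M.Normal] {f : G →* H}
    (hf : Function.Surjective f) (hM : f.ker = M) : Nonempty (G ⧸ M ≃* H) :=
  ⟨(QuotientGroup.quotientMulEquivOfEq hM.symm).trans
    (QuotientGroup.quotientKerEquivOfSurjective f hf)⟩

theorem nonempty_quotient_mulEquiv_of_prod {A : Type*} [CommGroup A] {s : A →* G} {M : Subgroup G}
    [M.Normal] (hM : s.range = M) {e : G ≃* A × A} (he : ∀ c, e (s c) = (c, c)) :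
    Nonempty (G ⧸ M ≃* A) := by
  have apply_div (g : G) :
      ((MonoidHom.fst A A / MonoidHom.snd A A).comp e.toMonoidHom) g = (e g).1 / (e g).2 := rfl
  refine nonempty_quotient_mulEquiv
    (f := (MonoidHom.fst A A / MonoidHom.snd A A).comp e.toMonoidHom) (fun c => ?_)
    (Subgroup.ext fun g => ?_)
  · exact ⟨e.symm (c, 1), by rw [apply_div, e.apply_symm_apply, div_one]⟩
  · rw [← hM, MonoidHom.mem_ker, apply_div, div_eq_one]
    constructor
    · exact fun h => ⟨(e g).1, e.injective ((he _).trans (Prod.ext rfl h))⟩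
    · rintro ⟨c, rfl⟩
      rw [he]

theorem nonempty_quotient_mulEquiv_of_semidirectProduct {φ : H →* MulAut N} {s : N →* G}
    {M : Subgroup G} [M.Normal] (hM : s.range = M) {e : N ⋊[φ] H ≃* G}
    (he : ∀ c, e (SemidirectProduct.inl c) = s c) : Nonempty (G ⧸ M ≃* H) := by
  refine nonempty_quotient_mulEquiv
    (f := SemidirectProduct.rightHom.comp (e.symm : G →* N ⋊[φ] H))
    (SemidirectProduct.rightHom_surjective.comp e.symm.surjective) ?_
  rw [MonoidHom.ker_comp_mulEquiv, ← SemidirectProduct.range_inl_eq_ker_rightHom,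
    MonoidHom.map_range, ← hM]
  exact congrArg MonoidHom.range (MonoidHom.ext he)

/-- The homomorphism from the cyclic group of order `n` given by an element of exponent `n`. -/
def zmodPowHom {n : ℕ} [NeZero n] {g : G} (hg : g ^ n = 1) : Multiplicative (ZMod n) →* G where
  toFun ε := g ^ ε.toAdd.val
  map_one' := by rw [toAdd_one, ZMod.val_zero, pow_zero]
  map_mul' ε δ := by rw [toAdd_mul, ZMod.val_add, ← pow_eq_pow_mod _ hg, pow_add]

theorem multiplicative_zmod_two (ε : Multiplicative (ZMod 2)) :
    ε = 1 ∨ ε = Multiplicative.ofAdd 1 := by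
  revert ε
  decide

theorem exists_semidirectProduct_mulEquiv {s : N →* G} (hs : Function.Injective s) {o : G}
    (ho : o ^ 2 = 1) (hso : ∀ c, s c * o = o * s c) (hos : o ∉ s.range)
    (h : ∀ g, ∃ c, g = s c ∨ g = s c * o) :
    ∃ e : N ⋊[(1 : Multiplicative (ZMod 2) →* MulAut N)] Multiplicative (ZMod 2) ≃* G,
      ∀ c, e (SemidirectProduct.inl c) = s c := by
  have zmodPowHom_ofAdd_one : zmodPowHom ho (Multiplicative.ofAdd 1) = o := pow_one o
  let f : N ⋊[(1 : Multiplicative (ZMod 2) →* MulAut N)] Multiplicative (ZMod 2) →* G :=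
    SemidirectProduct.lift s (zmodPowHom ho) fun ε => MonoidHom.ext fun c =>
      eq_mul_inv_of_mul_eq (Commute.pow_right (hso c) _)
  have f_apply g : f g = s g.left * zmodPowHom ho g.right := rfl
  refine ⟨MulEquiv.ofBijective f ⟨(injective_iff_map_eq_one f).mpr ?_, fun g => ?_⟩,
    fun c => ?_⟩
  · rintro ⟨c, ε⟩ hc
    rw [f_apply] at hc
    rcases multiplicative_zmod_two ε with rfl | rfl
    · rw [map_one, mul_one] at hc
      exact SemidirectProduct.ext ((map_eq_one_iff s hs).mp hc) rfl
    · rw [zmodPowHom_ofAdd_one] at hc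
      exact absurd ⟨c⁻¹, (map_inv s c).trans (inv_eq_of_mul_eq_one_right hc)⟩ hos
  · obtain ⟨c, rfl | rfl⟩ := h g
    · exact ⟨⟨c, 1⟩, by rw [f_apply, map_one, mul_one]⟩
    · exact ⟨⟨c, .ofAdd 1⟩, by rw [f_apply, zmodPowHom_ofAdd_one]⟩
  · exact (congrArg (s c * ·) (map_one (zmodPowHom ho))).trans (mul_one _)

end Group

/-! ## The Poisson operad -/

namespace PoisOperad

open SymOperad OpTerm

variable (k : Type u) [CommRing k]

/-- The commutative product. -/
def mul : (Pois k).obj 2 := genCls (Relators k) Gen.mul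

/-- The Poisson bracket. -/
def br : (Pois k).obj 2 := genCls (Relators k) Gen.bracket

theorem isPoisson : (Pois k).IsPoisson (unit k) (mul k) (br k) where
  mul_unit i := by
    fin_cases i
    · exact eval_genCls_eq (R := Relators k) Relators.unit_mul
    · exact eval_genCls_eq (R := Relators k) Relators.mul_unit
  bracket_unit i := by
    fin_cases i
    · exact eval_genCls_eq (R := Relators k) Relators.unit_bracket
    · exact eval_genCls_eq (R := Relators k) Relators.bracket_unit
  mul_comm := eval_genCls_eq (R := Relators k) Relators.mul_comm
  antisymm := (eval_genCls_eq (R := Relators k) Relators.antisymm).trans (neg_one_smul k (br k))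
  mul_assoc := eval_genCls_eq (R := Relators k) Relators.mul_assoc
  leibniz := eval_genCls_eq (R := Relators k) Relators.leibniz
  jacobi := eval_genCls_eq (R := Relators k) Relators.jacobi

variable {k} {Q : SymOperad.{u, w} k}

/-- The morphism to an operad given by a Poisson structure in it. -/
def lift {e : Q.obj 0} {m b : Q.obj 2} (h : Q.IsPoisson e m b) : Hom (Pois k) Q :=
  OpTerm.lift Q
    (fun _ x => match x with
      | Gen.unit => e
      | Gen.mul => m
      | Gen.bracket => b)
    fun _ _ _ hR => by
      cases hR with
      | unit_mul => exact h.mul_unit 0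
      | mul_unit => exact h.mul_unit 1
      | unit_bracket => exact h.bracket_unit 0
      | bracket_unit => exact h.bracket_unit 1
      | mul_comm => exact h.mul_comm
      | antisymm => exact h.antisymm.trans (neg_one_smul k b).symm
      | mul_assoc => exact h.mul_assoc
      | leibniz => exact h.leibniz
      | jacobi => exact h.jacobi

theorem hom_ext {f g : Hom (Pois k) Q} (h₀ : f.app 0 (unit k) = g.app 0 (unit k))
    (h₁ : f.app 2 (mul k) = g.app 2 (mul k)) (h₂ : f.app 2 (br k) = g.app 2 (br k)) : f = g :=
  OpTerm.hom_ext (R := Relators k) (by rintro n ⟨⟩ <;> assumption)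

theorem exists_eq_smul_one_of_mem (x : (Pois k).obj 2) (hx : x ∈ ({mul k, br k} : Set _))
    (i : Fin 2) : ∃ c : k, (Pois k).comp₂₀ i x (unit k) = c • (Pois k).one := by
  rcases hx with rfl | rfl
  · exact ⟨1, by rw [(isPoisson k).mul_unit, one_smul]⟩
  · exact ⟨0, by rw [(isPoisson k).bracket_unit, zero_smul]⟩

theorem binGen {n : ℕ} (x : (Pois k).obj n) (hn : 0 < n) :
    (Pois k).BinGen {mul k, br k} n x := by
  induction x using presented_induction with
  | @gen n x =>
    cases x with
    | unit => omega
    | mul => exact .gen _ (Or.inl rfl)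
    | bracket => exact .gen _ (Or.inr rfl)
  | one => exact .one
  | zero n => exact .zero n
  | add x y hx hy => exact .add x y (hx hn) (hy hn)
  | smul c x hx => exact .smul c x (hx hn)
  | act σ x hx => exact .act σ x (hx hn)
  | @comp m n r h i x y hx hy =>
    rcases Nat.eq_zero_or_pos n with rfl | hn'
    · obtain ⟨c, rfl⟩ := unit_span k y
      change (Pois k).BinGen _ r ((Pois k).comp h i x (c • unit k))
      rw [map_smul]
      exact .smul c _ (BinGen.comp_unit exists_eq_smul_one_of_mem (hx (Fin.pos i)) h hn i)
    · exact .comp h i x y (hx (Fin.pos i)) (hy hn')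

theorem mem_lowArity {n : ℕ} (x : (Pois k).obj n) (hn : 0 < n) :
    x ∈ lowArity (Submodule.span k {mul k, br k}) n := by
  refine (binGen x hn).mem_lowArity Submodule.subset_span fun y hy => ?_
  obtain ⟨a, b, rfl⟩ := Submodule.mem_span_pair.mp hy
  rw [map_add, map_smul, map_smul, (isPoisson k).mul_comm, (isPoisson k).antisymm, smul_neg,
    ← neg_smul]
  exact Submodule.mem_span_pair.mpr ⟨a, -b, rfl⟩

variable (k)

/-- The morphism to the operad of symbols on the plane. -/
def toSymbol : Hom (Pois k) (SymbolOperad.symbolOperad k (k × k)) :=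
  lift (SymbolOperad.isPoisson k)

theorem bijective_smul_one : Function.Bijective fun c : k => c • (Pois k).one :=
  ⟨(toSymbol k).injective_smul_one (SymbolOperad.injective_smul_one k (k × k)),
    fun x => Submodule.mem_span_singleton.mp (mem_lowArity x one_pos)⟩

theorem linearIndependent_mul_br : LinearIndependent k ![mul k, br k] := by
  refine LinearIndependent.pair_iff.mpr fun s t h =>
    LinearIndependent.pair_iff.mp (SymbolOperad.linearIndependent_mul_bracket k) s t ?_
  have h' := congrArg ((toSymbol k).app 2) h
  rwa [map_add, map_smul, map_smul, map_zero] at h'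

theorem sq_eq_zero_of_isAssociative {x y : k}
    (h : (Pois k).IsAssociative (x • mul k + y • br k)) : y ^ 2 = 0 := by
  have h' := h.map (toSymbol k)
  rw [map_add, map_smul, map_smul] at h'
  exact SymbolOperad.sq_eq_zero_of_isAssociative k h'

variable {k} {π : Hom (Pois k) Q} {N : ℕ}

theorem end_ext (hπ : ∀ n, Function.Surjective (π.app n)) {Φ Ψ : Q.EndHom}
    (h₀ : Φ.app 0 (π.app 0 (unit k)) = Ψ.app 0 (π.app 0 (unit k)))
    (h₁ : Φ.app 2 (π.app 2 (mul k)) = Ψ.app 2 (π.app 2 (mul k)))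
    (h₂ : Φ.app 2 (π.app 2 (br k)) = Ψ.app 2 (π.app 2 (br k))) : Φ = Ψ :=
  EndHom.eq_of_compHom_eq hπ (hom_ext (f := Φ.compHom π) (g := Ψ.compHom π) h₀ h₁ h₂)

theorem exists_eq_smul_add_smul (hπ : ∀ n, Function.Surjective (π.app n)) (x : Q.obj 2) :
    ∃ a b : k, x = a • π.app 2 (mul k) + b • π.app 2 (br k) := by
  obtain ⟨x, rfl⟩ := hπ 2 x
  obtain ⟨a, b, rfl⟩ := Submodule.mem_span_pair.mp (mem_lowArity x two_pos)
  exact ⟨a, b, by rw [map_add, map_smul, map_smul]⟩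

theorem exists_rescale (hπ : π.IsTruncation (unit k) N) (p : k × kˣ) :
    ∃ Ψ : Q.EndHom, ∀ n θ,
      Ψ.app n (π.app n θ) = π.app n ((lift ((isPoisson k).smul p.1 p.2)).app n θ) :=
  hπ.exists_endHom (lift ((isPoisson k).smul p.1 p.2)).toEndHom p.2⁻¹ rfl

/-- The endomorphism of a truncation of the Poisson operad multiplying the bracket by the first
scalar, the product by the second one and the unit by the inverse of the latter. -/
noncomputable def rescale (hπ : π.IsTruncation (unit k) N) (p : k × kˣ) : Q.EndHom :=
  (exists_rescale hπ p).choose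

theorem rescale_unit (hπ : π.IsTruncation (unit k) N) (p : k × kˣ) :
    (rescale hπ p).app 0 (π.app 0 (unit k)) = ((p.2⁻¹ : kˣ) : k) • π.app 0 (unit k) :=
  ((exists_rescale hπ p).choose_spec 0 _).trans (map_smul _ _ _)

theorem rescale_mul (hπ : π.IsTruncation (unit k) N) (p : k × kˣ) :
    (rescale hπ p).app 2 (π.app 2 (mul k)) = (p.2 : k) • π.app 2 (mul k) :=
  ((exists_rescale hπ p).choose_spec 2 _).trans (map_smul _ _ _)

theorem rescale_br (hπ : π.IsTruncation (unit k) N) (p : k × kˣ) :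
    (rescale hπ p).app 2 (π.app 2 (br k)) = p.1 • π.app 2 (br k) :=
  ((exists_rescale hπ p).choose_spec 2 _).trans (map_smul _ _ _)

/-- `rescale` as a homomorphism of monoids. -/
noncomputable def rescaleHom (hπ : π.IsTruncation (unit k) N) : k × kˣ →* Q.EndHom where
  toFun := rescale hπ
  map_one' := by
    refine end_ext hπ.surjective ?_ ?_ ?_
    · rw [rescale_unit, Prod.snd_one, inv_one, Units.val_one, one_smul, EndHom.one_app]
    · rw [rescale_mul, Prod.snd_one, Units.val_one, one_smul, EndHom.one_app]
    · rw [rescale_br, Prod.fst_one, one_smul, EndHom.one_app]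
  map_mul' p q := by
    refine end_ext hπ.surjective ?_ ?_ ?_
    · rw [EndHom.mul_app, rescale_unit, rescale_unit, map_smul, rescale_unit, smul_smul,
        Prod.snd_mul, mul_inv_rev, Units.val_mul]
    · rw [EndHom.mul_app, rescale_mul, rescale_mul, map_smul, rescale_mul, smul_smul,
        Prod.snd_mul, mul_comm, Units.val_mul]
    · rw [EndHom.mul_app, rescale_br, rescale_br, map_smul, rescale_br, smul_smul, Prod.fst_mul,
        mul_comm]

theorem rescaleHom_injective (hπ : π.IsTruncation (unit k) 3) :
    Function.Injective (rescaleHom hπ) := by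
  intro p q h
  replace h : rescale hπ p = rescale hπ q := h
  have hmb := hπ.linearIndependent_pair (by omega) (linearIndependent_mul_br k)
  refine Prod.ext (hmb.smul_left_injective 1 ?_) (Units.ext (hmb.smul_left_injective 0 ?_))
  · exact (rescale_br hπ p).symm.trans (h ▸ rescale_br hπ q)
  · exact (rescale_mul hπ p).symm.trans (h ▸ rescale_mul hπ q)

theorem rescaleHom_surjective (hπ : π.IsTruncation (unit k) 3)
    (hassoc : ∀ x y : k, 2 * y = 0 →
      Q.IsAssociative (x • π.app 2 (mul k) + y • π.app 2 (br k)) → y = 0) :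
    Function.Surjective (rescaleHom hπ) := by
  intro Φ
  obtain ⟨a, ha⟩ := hπ.exists_eq_smul (unit_span k) (Φ.app 0 (π.app 0 (unit k)))
  obtain ⟨x, y, hxy⟩ := exists_eq_smul_add_smul hπ.surjective (Φ.app 2 (π.app 2 (mul k)))
  obtain ⟨z, t, hzt⟩ := exists_eq_smul_add_smul hπ.surjective (Φ.app 2 (π.app 2 (br k)))
  have hΦ : Q.IsPoisson (Φ.app 0 (π.app 0 (unit k))) (Φ.app 2 (π.app 2 (mul k)))
      (Φ.app 2 (π.app 2 (br k))) := (isPoisson k).map (Φ.compHom π)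
  rw [ha, hxy, hzt] at hΦ
  obtain ⟨hax, hy, rfl⟩ := ((isPoisson k).map π).coeff_eq
    (hπ.bijective_smul_one (by omega) (bijective_smul_one k)).1
    (hπ.linearIndependent_pair (by omega) (linearIndependent_mul_br k)) hΦ
  obtain rfl := hassoc x y hy hΦ.mul_assoc
  refine ⟨(t, ⟨x, a, (mul_comm x a).trans hax, hax⟩), end_ext hπ.surjective ?_ ?_ ?_⟩
  · exact (rescale_unit hπ _).trans ha.symm
  · refine (rescale_mul hπ _).trans ?_
    rw [hxy, zero_smul, add_zero]
  · refine (rescale_br hπ _).trans ?_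
    rw [hzt, zero_smul, zero_add]

theorem exists_endHom_mulEquiv (hπ : π.IsTruncation (unit k) 3)
    (hassoc : ∀ x y : k, 2 * y = 0 →
      Q.IsAssociative (x • π.app 2 (mul k) + y • π.app 2 (br k)) → y = 0) :
    ∃ e : Q.EndHom ≃* k × kˣ, ∀ c : kˣ, e (Q.scale c).1 = ((c : k), c) := by
  refine ⟨(MulEquiv.ofBijective (rescaleHom hπ)
    ⟨rescaleHom_injective hπ, rescaleHom_surjective hπ hassoc⟩).symm, fun c => ?_⟩
  refine (MulEquiv.symm_apply_eq _).mpr (end_ext hπ.surjective ?_ ?_ ?_)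
  · exact (scale_app_zero c _).trans (rescale_unit hπ (c, c)).symm
  · exact (scale_app_two c _).trans (rescale_mul hπ (c, c)).symm
  · exact (scale_app_two c _).trans (rescale_br hπ (c, c)).symm

theorem exists_isTruncation (hk : ∀ e : k, 2 * e = 0 → e * e = 0 → e = 0) {P : SymOperad.{u, u} k}
    (hP : P = Pois k ∨ ∃ K : ℕ, 3 ≤ K ∧ (K = 3 → ∀ e : k, 2 * e = 0 → e = 0) ∧
      P = PoisTrunc k K) :
    ∃ π : Hom (Pois k) P, π.IsTruncation (unit k) 3 ∧ ∀ x y : k, 2 * y = 0 →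
      P.IsAssociative (x • π.app 2 (mul k) + y • π.app 2 (br k)) → y = 0 := by
  have of_injective {P : SymOperad.{u, u} k} {π : Hom (Pois k) P}
      (hπ : Function.Injective (π.app 3)) (x y : k) (hy : 2 * y = 0)
      (h : P.IsAssociative (x • π.app 2 (mul k) + y • π.app 2 (br k))) : y = 0 := by
    refine hk y hy ((pow_two y).symm.trans (sq_eq_zero_of_isAssociative k (x := x) ?_))
    exact .of_map hπ (by rwa [map_add, map_smul, map_smul])
  rcases hP with rfl | ⟨K, hK, hk₃, rfl⟩
  · exact ⟨Hom.id _, isTruncation_id _ _, of_injective Function.injective_id⟩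
  · have hπ := isTruncation_quotMk (unit_span k) hK
    refine ⟨_, hπ, fun x y hy h => ?_⟩
    rcases hK.eq_or_lt with rfl | hK
    · exact hk₃ rfl y hy
    · exact of_injective ((isTruncation_quotMk (unit_span k) hK).injective 3 (by omega)) x y hy h

end PoisOperad

/-! ## The associative operad -/

theorem permComp_one_one {m n r : ℕ} (h : r + 1 = m + n) (i : Fin m) :
    permComp h 1 i (1 : Equiv.Perm (Fin n)) = 1 :=
  left_eq_mul.mp (permComp_mul h 1 1 i 1 1)

theorem permComp_revPerm {m n r : ℕ} (h : r + 1 = m + n) (i : Fin m) :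
    permComp h Fin.revPerm i (Fin.revPerm : Equiv.Perm (Fin n)) = Fin.revPerm := by
  ext p
  rcases ins_cases h i p with ⟨j, hj, hp⟩ | ⟨t, hp⟩
  · have hj' : j.1 ≠ i.1 := Fin.val_ne_of_ne hj
    rw [permComp_inl h _ i _ p j hj hp]
    simp only [Fin.revPerm_apply, Fin.val_rev]
    split_ifs at hp ⊢ <;> omega
  · rw [permComp_inr h _ i _ p t hp]
    simp only [Fin.revPerm_apply, Fin.val_rev]
    omega

namespace AsOperad

open SymOperad

variable (k : Type u) [CommRing k]

/-- The basis of `As n` formed by the permutations. The operation `x₁ ⋯ xₙ` is `basis k n 1`, and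
`basis k 2 (Equiv.swap 0 1)` is the opposite product. -/
noncomputable def basis (n : ℕ) : Module.Basis (Equiv.Perm (Fin n)) k ((As k).obj n) :=
  Finsupp.basisSingleOne

theorem act_basis {n : ℕ} (σ τ : Equiv.Perm (Fin n)) :
    (As k).act σ (basis k n τ) = basis k n (τ * σ) :=
  Finsupp.mapDomain_single

theorem comp_basis {m n r : ℕ} (h : r + 1 = m + n) (i : Fin m) (σ : Equiv.Perm (Fin m))
    (τ : Equiv.Perm (Fin n)) :
    (As k).comp h i (basis k m σ) (basis k n τ) = basis k r (permComp h σ i τ) :=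
  (comp_single k h i σ τ 1 1).trans (congrArg (Finsupp.single _) (mul_one 1))

theorem basis_zero (σ : Equiv.Perm (Fin 0)) : basis k 0 σ = unit k :=
  congrArg (basis k 0) (Subsingleton.elim σ 1)

theorem basis_one (σ : Equiv.Perm (Fin 1)) : basis k 1 σ = (As k).one :=
  congrArg (basis k 1) (Subsingleton.elim σ 1)

theorem bijective_smul_one : Function.Bijective fun c : k => c • (As k).one := by
  refine ⟨?_, fun x => ⟨(basis k 1).repr x 1, ?_⟩⟩
  · rw [← basis_one k 1]
    exact (basis k 1).linearIndependent.smul_left_injective 1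
  · have hx := (basis k 1).sum_repr x
    rwa [Fintype.sum_unique, basis_one, Subsingleton.elim default 1] at hx

theorem linearIndependent_mul_op :
    LinearIndependent k ![basis k 2 1, basis k 2 (Equiv.swap 0 1)] := by
  have hinj : Function.Injective ![(1 : Equiv.Perm (Fin 2)), Equiv.swap 0 1] := by decide
  convert (basis k 2).linearIndependent.comp _ hinj using 1
  ext i
  fin_cases i <;> rfl

theorem mem_span_mul_op (x : (As k).obj 2) :
    x ∈ Submodule.span k {basis k 2 1, basis k 2 (Equiv.swap 0 1)} := by
  refine Submodule.span_mono ?_ ((basis k 2).mem_span x)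
  rintro _ ⟨σ, rfl⟩
  exact (perm_fin_two σ).imp (congrArg _) (congrArg _)

theorem comp₂₀_unit (i : Fin 2) (σ : Equiv.Perm (Fin 2)) :
    (As k).comp₂₀ i (basis k 2 σ) (unit k) = (As k).one := by
  rw [← basis_zero k 1, comp_basis, basis_one]

theorem isAssociative_mul : (As k).IsAssociative (basis k 2 1) := by
  rw [IsAssociative, comp_basis, comp_basis, permComp_one_one, permComp_one_one]

theorem mul_eq_zero_of_isAssociative {a b : k}
    (h : (As k).IsAssociative (a • basis k 2 1 + b • basis k 2 (Equiv.swap 0 1))) :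
    a * b = 0 := by
  -- For `μ = a xy + b yx`, the monomial `yxz` has the coefficient `a b` in `μ ∘₁ μ` and does not
  -- occur in `μ ∘₂ μ`.
  have hcoeff := congrArg ((basis k 3).coord (Equiv.swap 0 1)) h
  simp +decide only [map_add, map_smul, LinearMap.add_apply, LinearMap.smul_apply, comp_basis,
    Module.Basis.coord_apply, Module.Basis.repr_self, Finsupp.single_apply, if_true, if_false,
    smul_eq_mul, mul_zero, mul_one, add_zero, zero_add] at hcoeff
  exact (mul_comm a b).trans hcoeff

variable {k} in
theorem hom_ext {Q : SymOperad.{u, w} k} {f g : Hom (As k) Q}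
    (h₀ : f.app 0 (unit k) = g.app 0 (unit k))
    (h₂ : f.app 2 (basis k 2 1) = g.app 2 (basis k 2 1)) : f = g := by
  have h₁ (n : ℕ) : f.app n (basis k n 1) = g.app n (basis k n 1) := by
    induction n with
    | zero => exact h₀
    | succ n ih =>
      have hn := comp_basis k (m := 2) (n := n) (r := n + 1) (by omega) 0 1 1
      rw [permComp_one_one] at hn
      rw [← hn, f.app_comp, g.app_comp, h₂, ih]
  refine Hom.ext_app fun n θ => LinearMap.congr_fun ((basis k n).ext fun σ => ?_) θ
  rw [← one_mul σ, ← act_basis, f.app_act, g.app_act, h₁]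

/-- The linear map reversing the order of the factors in the products `x_{i₁} ⋯ x_{iₙ}`. -/
noncomputable def opMap (n : ℕ) : (As k).obj n →ₗ[k] (As k).obj n :=
  (basis k n).constr k fun σ => basis k n (Fin.revPerm * σ)

theorem opMap_basis {n : ℕ} (σ : Equiv.Perm (Fin n)) :
    opMap k n (basis k n σ) = basis k n (Fin.revPerm * σ) :=
  (basis k n).constr_basis k _ σ

/-- The endomorphism of `As` corresponding to the passage to opposite algebras. -/
noncomputable def opEnd : (As k).EndHom where
  app := opMap k
  app_one := by rw [← basis_one k 1, opMap_basis, basis_one, basis_one]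
  app_act {n} σ θ := by
    have h : opMap k n ∘ₗ (As k).act σ = (As k).act σ ∘ₗ opMap k n := by
      refine (basis k n).ext fun τ => ?_
      simp only [LinearMap.comp_apply, act_basis, opMap_basis, mul_assoc]
    exact LinearMap.congr_fun h θ
  app_comp {m n r} h i μ ν := by
    have h' : ((As k).comp h i).compr₂ (opMap k r) =
        ((As k).comp h i).compl₁₂ (opMap k m) (opMap k n) := by
      refine (basis k m).ext fun σ => (basis k n).ext fun τ => ?_
      rw [LinearMap.compr₂_apply, LinearMap.compl₁₂_apply, comp_basis, opMap_basis, opMap_basis,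
        opMap_basis, comp_basis, permComp_mul, permComp_revPerm]
    exact LinearMap.congr_fun₂ h' μ ν

theorem opEnd_unit : (opEnd k).app 0 (unit k) = unit k :=
  (opMap_basis k 1).trans (basis_zero k _)

theorem opEnd_mul : (opEnd k).app 2 (basis k 2 1) = basis k 2 (Equiv.swap 0 1) :=
  (opMap_basis k 1).trans (congrArg (basis k 2) (by decide))

theorem opEnd_op : (opEnd k).app 2 (basis k 2 (Equiv.swap 0 1)) = basis k 2 1 :=
  (opMap_basis k _).trans (congrArg (basis k 2) (by decide))

variable {k} {Q : SymOperad.{u, w} k} {π : Hom (As k) Q} {N : ℕ}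

theorem end_ext (hπ : ∀ n, Function.Surjective (π.app n)) {Φ Ψ : Q.EndHom}
    (h₀ : Φ.app 0 (π.app 0 (unit k)) = Ψ.app 0 (π.app 0 (unit k)))
    (h₂ : Φ.app 2 (π.app 2 (basis k 2 1)) = Ψ.app 2 (π.app 2 (basis k 2 1))) : Φ = Ψ :=
  EndHom.eq_of_compHom_eq hπ (hom_ext (f := Φ.compHom π) (g := Ψ.compHom π) h₀ h₂)

theorem exists_opAut (hπ : π.IsTruncation (unit k) N) :
    ∃ o : Q.AutGroup, o ^ 2 = 1 ∧ o.1.app 0 (π.app 0 (unit k)) = π.app 0 (unit k) ∧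
      o.1.app 2 (π.app 2 (basis k 2 1)) = π.app 2 (basis k 2 (Equiv.swap 0 1)) := by
  obtain ⟨Ψ, hΨ⟩ := hπ.exists_endHom (opEnd k) 1 (by rw [opEnd_unit, Units.val_one, one_smul])
  have hΨΨ : Ψ * Ψ = 1 := by
    refine end_ext hπ.surjective ?_ ?_
    · rw [EndHom.mul_app, hΨ, hΨ, opEnd_unit, opEnd_unit, EndHom.one_app]
    · rw [EndHom.mul_app, hΨ, hΨ, opEnd_mul, opEnd_op, EndHom.one_app]
  refine ⟨⟨Ψ, Ψ, hΨΨ, hΨΨ⟩, Units.ext ((pow_two Ψ).trans hΨΨ), ?_, ?_⟩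
  · exact (hΨ 0 _).trans (congrArg _ (opEnd_unit k))
  · exact (hΨ 2 _).trans (congrArg _ (opEnd_mul k))

theorem exists_eq_smul_add_smul (hπ : Function.Surjective (π.app 2)) (x : Q.obj 2) :
    ∃ a b : k, x = π.app 2 (a • basis k 2 1 + b • basis k 2 (Equiv.swap 0 1)) := by
  obtain ⟨x, rfl⟩ := hπ x
  obtain ⟨a, b, rfl⟩ := Submodule.mem_span_pair.mp (mem_span_mul_op k x)
  exact ⟨a, b, rfl⟩

theorem mul_add_eq_one (hQ : Function.Injective fun c : k => c • Q.one) {Φ : Q.EndHom}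
    {a b u : k} (hu : Φ.app 0 (π.app 0 (unit k)) = u • π.app 0 (unit k))
    (hab : Φ.app 2 (π.app 2 (basis k 2 1)) =
      π.app 2 (a • basis k 2 1 + b • basis k 2 (Equiv.swap 0 1))) : u * (a + b) = 1 := by
  have plug_unit (σ : Equiv.Perm (Fin 2)) :
      Q.comp₂₀ 0 (π.app 2 (basis k 2 σ)) (π.app 0 (unit k)) = Q.one := by
    rw [← π.app_comp₂₀, comp₂₀_unit, π.app_one]
  have hone := congrArg (Φ.app 1) (plug_unit 1)
  rw [Φ.app_one, Φ.app_comp, hu, hab] at hone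
  simp only [map_add, map_smul, LinearMap.add_apply, LinearMap.smul_apply, plug_unit,
    ← add_smul, smul_smul] at hone
  exact hQ (hone.trans (one_smul k _).symm)

/-- An endomorphism sends the product `m` to an associative combination of `m` and its opposite,
and the unit to `u` times itself; `u a` is then an idempotent, which decides between the two. -/
theorem eq_scale_or_eq_scale_mul (hk : ∀ e : k, e * e = e → e = 0 ∨ e = 1)
    (hπ : π.IsTruncation (unit k) 4) {o : Q.AutGroup}
    (ho₀ : o.1.app 0 (π.app 0 (unit k)) = π.app 0 (unit k))
    (ho₂ : o.1.app 2 (π.app 2 (basis k 2 1)) = π.app 2 (basis k 2 (Equiv.swap 0 1)))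
    (Φ : Q.EndHom) : ∃ c : kˣ, Φ = (Q.scale c).1 ∨ Φ = (Q.scale c * o).1 := by
  obtain ⟨u, hu⟩ := hπ.exists_eq_smul (unit_span k) (Φ.app 0 (π.app 0 (unit k)))
  obtain ⟨a, b, hab⟩ :=
    exists_eq_smul_add_smul (hπ.surjective 2) (Φ.app 2 (π.app 2 (basis k 2 1)))
  have huab : u * (a + b) = 1 :=
    mul_add_eq_one (hπ.bijective_smul_one (by omega) (bijective_smul_one k)).1 hu hab
  have hab₀ : a * b = 0 := by
    refine mul_eq_zero_of_isAssociative k (.of_map (hπ.injective 3 (by omega)) ?_)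
    exact hab ▸ (isAssociative_mul k).map (Φ.compHom π)
  rcases hk (u * a) (by linear_combination (u * a) * huab - u * u * hab₀) with h | h
  · obtain rfl : a = 0 := by linear_combination a * h - a * huab + u * hab₀
    rw [zero_add] at huab
    refine ⟨⟨b, u, (mul_comm b u).trans huab, huab⟩, .inr (end_ext hπ.surjective ?_ ?_)⟩
    · rw [Units.val_mul, EndHom.mul_app, scale_app_zero, ho₀, hu]
      rfl
    · rw [Units.val_mul, EndHom.mul_app, scale_app_two, ho₂, hab, zero_smul, zero_add, map_smul]
  · obtain rfl : b = 0 := by linear_combination u * hab₀ - b * h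
    rw [add_zero] at huab
    refine ⟨⟨a, u, (mul_comm a u).trans huab, huab⟩, .inl (end_ext hπ.surjective ?_ ?_)⟩
    · rw [scale_app_zero, hu]
      rfl
    · rw [scale_app_two, hab, zero_smul, add_zero, map_smul]

theorem isUnit_endHom (hk : ∀ e : k, e * e = e → e = 0 ∨ e = 1)
    (hπ : π.IsTruncation (unit k) 4) (Φ : Q.EndHom) : IsUnit Φ := by
  obtain ⟨o, -, ho₀, ho₂⟩ := exists_opAut hπ
  obtain ⟨c, rfl | rfl⟩ := eq_scale_or_eq_scale_mul hk hπ ho₀ ho₂ Φ <;> exact Units.isUnit _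

theorem injective_smul_mul : Function.Injective fun c : k => c • basis k 2 1 :=
  (basis k 2).linearIndependent.smul_left_injective 1

theorem exists_semidirectProduct_mulEquiv [Nontrivial k]
    (hk : ∀ e : k, e * e = e → e = 0 ∨ e = 1) (hπ : π.IsTruncation (unit k) 4) :
    ∃ e : kˣ ⋊[(1 : Multiplicative (ZMod 2) →* MulAut kˣ)] Multiplicative (ZMod 2) ≃* Q.AutGroup,
      ∀ c : kˣ, e (SemidirectProduct.inl c) = Q.scale c := by
  obtain ⟨o, ho, ho₀, ho₂⟩ := exists_opAut hπ
  refine _root_.exists_semidirectProduct_mulEquiv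
    (hπ.scale_injective (by omega) injective_smul_mul) ho
    (fun c => scale_mul_comm c o) ?_ fun Φ => ?_
  · rintro ⟨c, rfl⟩
    rw [scale_app_two] at ho₂
    have hpair := LinearIndependent.pair_iff.mp
      (hπ.linearIndependent_pair (by omega) (linearIndependent_mul_op k)) c (-1)
    exact c.ne_zero (hpair (by rw [ho₂, neg_one_smul, add_neg_cancel])).1
  · obtain ⟨c, hc⟩ := eq_scale_or_eq_scale_mul hk hπ ho₀ ho₂ Φ.1
    exact ⟨c, hc.imp Units.ext Units.ext⟩

theorem exists_isTruncation {P : SymOperad.{u, u} k}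
    (hP : P = As k ∨ ∃ K : ℕ, 4 ≤ K ∧ P = AsTrunc k K) :
    ∃ π : Hom (As k) P, π.IsTruncation (unit k) 4 := by
  rcases hP with rfl | ⟨K, hK, rfl⟩
  · exact ⟨_, isTruncation_id _ _⟩
  · exact ⟨_, isTruncation_quotMk (unit_span k) hK⟩

end AsOperad

theorem proposition3p3 (k : Type u) [CommRing k] :
    -- `As` and `As / ^K I` for `K ≥ 4`
    (Nontrivial k → (∀ e : k, e * e = e → e = 0 ∨ e = 1) →
      ∀ P : SymOperad.{u, u} k,
        (P = AsOperad.As k ∨ ∃ K : ℕ, 4 ≤ K ∧ P = AsOperad.AsTrunc k K) →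
        (Function.Injective P.scale ∧ P.scale.range = P.IAut) ∧
        (∃ e : kˣ ⋊[(1 : Multiplicative (ZMod 2) →* MulAut kˣ)] Multiplicative (ZMod 2) ≃*
            P.AutGroup, ∀ c : kˣ, e (SemidirectProduct.inl c) = P.scale c) ∧
        Nonempty (P.OAut ≃* Multiplicative (ZMod 2)) ∧
        (∀ Φ : P.EndHom, IsUnit Φ)) ∧
    -- `Lie`
    ((Function.Injective (LieOperad.Lie k).scale ∧
        (LieOperad.Lie k).scale.range = (LieOperad.Lie k).IAut) ∧
      (LieOperad.Lie k).IAut = ⊤ ∧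
      Subsingleton (LieOperad.Lie k).OAut ∧
      (∃ e : (LieOperad.Lie k).EndHom ≃* k, ∀ c : kˣ, e ((LieOperad.Lie k).scale c).1 = c)) ∧
    -- `Pois` and `Pois / ^K I` for `K ≥ 3`
    ((∀ e : k, 2 * e = 0 → e * e = 0 → e = 0) →
      ∀ P : SymOperad.{u, u} k,
        (P = PoisOperad.Pois k ∨
          ∃ K : ℕ, 3 ≤ K ∧ (K = 3 → ∀ e : k, 2 * e = 0 → e = 0) ∧
            P = PoisOperad.PoisTrunc k K) →
        (Function.Injective P.scale ∧ P.scale.range = P.IAut) ∧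
        (∃ e : P.AutGroup ≃* kˣ × kˣ, ∀ c : kˣ, e (P.scale c) = (c, c)) ∧
        Nonempty (P.OAut ≃* kˣ) ∧
        (∃ e : P.EndHom ≃* k × kˣ, ∀ c : kˣ, e (P.scale c).1 = ((c : k), c))) := by
  refine ⟨fun _ hk P hP => ?_, ?_, fun hk P hP => ?_⟩
  · obtain ⟨π, hπ⟩ := AsOperad.exists_isTruncation hP
    obtain ⟨e, he⟩ := AsOperad.exists_semidirectProduct_mulEquiv hk hπ
    have hI := SymOperad.range_scale_eq_IAut
      (hπ.bijective_smul_one (by omega) (AsOperad.bijective_smul_one k))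
    exact ⟨⟨hπ.scale_injective (by omega) AsOperad.injective_smul_mul, hI⟩, ⟨e, he⟩,
      nonempty_quotient_mulEquiv_of_semidirectProduct hI he, AsOperad.isUnit_endHom hk hπ⟩
  · have hI := SymOperad.range_scale_eq_IAut (LieOperad.bijective_smul_one k)
    have htop := hI.symm.trans (LieOperad.range_scale_eq_top k)
    refine ⟨⟨SymOperad.scale_injective (LieOperad.bijective_smul_br k).1, hI⟩, htop, ?_,
      LieOperad.endEquiv k, LieOperad.endEquiv_scale k⟩
    rw [SymOperad.OAut, htop]
    exact QuotientGroup.subsingleton_quotient_top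
  · obtain ⟨π, hπ, hassoc⟩ := PoisOperad.exists_isTruncation hk hP
    obtain ⟨e, he⟩ := PoisOperad.exists_endHom_mulEquiv hπ hassoc
    obtain ⟨e', he'⟩ := SymOperad.exists_autGroup_mulEquiv he
    have hI := SymOperad.range_scale_eq_IAut
      (hπ.bijective_smul_one (by omega) (PoisOperad.bijective_smul_one k))
    exact ⟨⟨hπ.scale_injective (by omega)
        ((PoisOperad.linearIndependent_mul_br k).smul_left_injective 0), hI⟩,
      ⟨e', he'⟩, nonempty_quotient_mulEquiv_of_prod hI he', e, he⟩
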